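/- Let $d\ge 1$, $a,m,k,\ell\ge 0$, $n=d+a$, and let $\mathcal E,\mathcal A\in\mathbb R^{n\times n}$, $\mathcal B\in\mathbb R^{n\times m}$, $\mathcal C\in\mathbb R^{k\times n}$, $\mathcal F\in\mathbb R^{\ell\times n}$, $x_0\in\mathbb R^n$. For $t_1>0$ consider the problem of minimizing $$\tfrac12\int_0^{t_1}\|\mathcal Cx(s)\|^2+\|u(s)\|^2\,ds+\tfrac12\|\mathcal Fx(t_1)\|^2$$ subject to $\mathcal E\dot x=\mathcal Ax+\mathcal Bu$ on $[0,t_1]$, $\mathcal Ex(0)=\mathcal Ex_0$, over all square integrable pairs $(x,u)$ for which $\mathcal Ex$ is absolutely continuous and the equation holds almost everywhere (Euclidean norms). Assume the following. (1) $\mathcal E=\begin{bmatrix}I_d&0\\0&0\end{bmatrix}$; all matrices are partitioned accordingly, $\mathcal A=\begin{bmatrix}A_{11}&A_{12}\\A_{21}&A_{22}\end{bmatrix}$, $\mathcal B=\begin{bmatrix}B_1\\B_2\end{bmatrix}$, $\mathcal C=\begin{bmatrix}C_1&C_2\end{bmatrix}$. (2) $\operatorname{range}\mathcal F^*\subset\operatorname{range}\mathcal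 E^*$; $S$ denotes the upper left $d\times d$ block of $\mathcal F^*\mathcal F$. (3) $(\mathcal E,\mathcal A)$ is regular (i.e. $s\mathcal E-\mathcal A$ is invertible for some $s\in\mathbb C$), and $\mathcal P_+$ is a stabilizing solution of the generalized algebraic Riccati equation $$\mathcal A^*X+X^*\mathcal A-X^*\mathcal B\mathcal B^*X+\mathcal C^*\mathcal C=0,\qquad \mathcal E^*X=X^*\mathcal E,$$ that is, for $\mathcal A_+:=\mathcal A-\mathcal B\mathcal B^*\mathcal P_+$ the pair $(\mathcal E,\mathcal A_+)$ is regular, impulse-free ($\operatorname{rank}\begin{bmatrix}\mathcal E&0\\\mathcal A_+&\mathcal E\end{bmatrix}=n+\operatorname{rank}\mathcal E$) and finite dynamics stable (in a decoupled form $L\mathcal ER=\operatorname{diag}(I,N)$, $L\mathcal A_+R=\operatorname{diag}(J,I)$ with invertible $L,R$ and nilpotent $N$, all eigenvalues of $J$ have negative real part). Write $\mathcal P_+=\begin{bmatrix}P_{+;1}&0\\P_{+;21}&P_{+;2}\end{bmatrix}$ and $\mathcal A_+=\begin{bmatrix}A_{+;1}&A_{+;12}\\A_{+;21}&A_{+;2}\end{bmatrix}$.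 (4) With $K_2:=A_{22}^*-P_{+;2}^*B_2B_2^*$ (which is invertible by (3)), the matrix $$\tilde Q:=C_1^*C_1-(A_{21}^*P_{+;2}+C_1^*C_2)K_2^{-*}A_{21}-A_{21}^*K_2^{-1}(C_2^*C_1+P_{+;2}^*A_{21})-(C_1^*C_2+A_{21}^*P_{+;2})K_2^{-*}B_2B_2^*K_2^{-1}(C_2^*C_1+P_{+;2}^*A_{21})$$ is positive semidefinite. (5) With $\bar A:=A_{+;1}-A_{+;12}A_{+;2}^{-1}A_{+;21}$, $\bar B:=B_1-A_{+;12}A_{+;2}^{-1}B_2$ and $\bar W:=\int_0^\infty e^{s\bar A}\bar B\bar B^*e^{s\bar A^*}\,ds$, the matrix $I+\bar W(S-P_{+;1})$ is invertible. Let $\bar\sigma$ be the spectral abscissa (largest real part of an eigenvalue) of $\bar A$. Then $\bar\sigma<0$, and for every $t_1>0$ the problem has a solution $(x,u)=(x_{t_1},u_{t_1})$, which also solves the differential-algebraic equation classically ($x$ differentiable and $u$ continuous on $[0,t_1]$), such that $$\|x_{t_1}(t)\|\le c\,(e^{\sigma t}+e^{\sigma(t_1-t)}),\qquad \|u_{t_1}(t)\|\le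 c\,(e^{\sigma t}+e^{\sigma(t_1-t)})\qquad\text{for all } t_1>0,\ t\in[0,t_1],$$ with a constant $c>0$ independent of $t$ and $t_1$, in each of the following cases: (i) $\sigma=\bar\sigma$, provided that every eigenvalue of $\bar A$ with real part $\bar\sigma$ is semisimple; (ii) for every $\sigma\in(\bar\sigma,0)$, with no further condition (and $c$ depending on $\sigma$). -/

import Mathlib

open Matrix Set MeasureTheory

noncomputable section

namespace DAETurnpike

section Pencils

variable {ι : Type*} [Fintype ι] [DecidableEq ι]

/-- A real square matrix, viewed as a complex one. -/
def toComplex {p q : Type*} (M : Matrix p q ℝ) : Matrix p q ℂ := M.map Complex.ofReal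

/-- The pair `(E, A)` is regular: `s E - A` is invertible for some complex number `s`. -/
def IsRegularPair (E A : Matrix ι ι ℝ) : Prop :=
  ∃ s : ℂ, IsUnit (s • toComplex E - toComplex A)

/-- A decoupled form of the pair `(E, A)`: an equivalence transformation with invertible complex
matrices `L`, `R` that brings `E` to `diag(I, N)` and `A` to `diag(J, I)`, with `N` nilpotent.
The block `J` belongs to the slow subsystem; it is determined by `(E, A)` up to similarity. -/
structure DecoupledForm (E A : Matrix ι ι ℝ) where
  r : ℕ
  q : ℕ
  e : ι ≃ Fin r ⊕ Fin q
  L : Matrix ι ι ℂ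
  R : Matrix ι ι ℂ
  J : Matrix (Fin r) (Fin r) ℂ
  N : Matrix (Fin q) (Fin q) ℂ
  isUnit_L : IsUnit L
  isUnit_R : IsUnit R
  nilpotent_N : IsNilpotent N
  transform_E : L * toComplex E * R = (fromBlocks 1 0 0 N).submatrix e e
  transform_A : L * toComplex A * R = (fromBlocks J 0 0 1).submatrix e e

/-- The pair is finite dynamics stable: it is regular and all eigenvalues of the matrix of its
slow subsystem have negative real part. -/
def IsFiniteDynamicsStable (E A : Matrix ι ι ℝ) : Prop :=
  IsRegularPair E A ∧ ∃ W : DecoupledForm E A, ∀ μ ∈ spectrum ℂ W.J, μ.re < 0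

/-- The pair is impulse-free: it is regular and `rank [E 0; A E] = n + rank E`. -/
def IsImpulseFree (E A : Matrix ι ι ℝ) : Prop :=
  IsRegularPair E A ∧ (fromBlocks E 0 A E).rank = Fintype.card ι + E.rank

/-- The spectral abscissa: the largest real part of the complex eigenvalues (meaningful for
matrices of positive size). -/
def spectralAbscissa (M : Matrix ι ι ℝ) : ℝ :=
  sSup (Complex.re '' spectrum ℂ (toComplex M))

/-- All eigenvalues whose real part equals the spectral abscissa are semisimple, that is, the
kernels of `(M - μ)²` and `M - μ` agree. -/
def HasSemisimpleAbscissa (M : Matrix ι ι ℝ) : Prop :=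
  ∀ μ ∈ spectrum ℂ (toComplex M), μ.re = spectralAbscissa M →
    ∀ v : ι → ℂ, (toComplex M - μ • 1) ^ 2 *ᵥ v = 0 → (toComplex M - μ • 1) *ᵥ v = 0

end Pencils

section Riccati

variable {ι κ μ : Type*} [Fintype ι] [DecidableEq ι] [Fintype κ] [Fintype μ]

/-- The closed loop matrix `A - B B* X`. -/
def closedLoop (A : Matrix ι ι ℝ) (B : Matrix ι μ ℝ) (X : Matrix ι ι ℝ) : Matrix ι ι ℝ :=
  A - B * Bᵀ * X

/-- `X` is a stabilizing solution of the generalized algebraic Riccati equation. -/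
structure IsStabilizingSolution (E A : Matrix ι ι ℝ) (B : Matrix ι μ ℝ) (C : Matrix κ ι ℝ)
    (X : Matrix ι ι ℝ) : Prop where
  riccati : Aᵀ * X + Xᵀ * A - Xᵀ * B * Bᵀ * X + Cᵀ * C = 0
  symm : Eᵀ * X = Xᵀ * E
  regular : IsRegularPair E (closedLoop A B X)
  impulseFree : IsImpulseFree E (closedLoop A B X)
  stable : IsFiniteDynamicsStable E (closedLoop A B X)

end Riccati

section Blocks

variable {d a κ μ : Type*} [Fintype d] [DecidableEq d] [Fintype a] [DecidableEq a]
  [Fintype κ] [Fintype μ]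

/-- `K₂ = A₂₂* - P₂* B₂ B₂*`, where `P₂` is the lower right block of `X`. -/
def K2 (A : Matrix (d ⊕ a) (d ⊕ a) ℝ) (B : Matrix (d ⊕ a) μ ℝ) (X : Matrix (d ⊕ a) (d ⊕ a) ℝ) :
    Matrix a a ℝ :=
  A.toBlocks₂₂ᵀ - X.toBlocks₂₂ᵀ * B.toRows₂ * B.toRows₂ᵀ

/-- The constant term of the Riccati equation for the differential part, with
`K₂^{-*}` written as `(K₂⁻¹)ᵀ`. -/
def Qtilde (A : Matrix (d ⊕ a) (d ⊕ a) ℝ) (B : Matrix (d ⊕ a) μ ℝ) (C : Matrix κ (d ⊕ a) ℝ)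
    (X : Matrix (d ⊕ a) (d ⊕ a) ℝ) : Matrix d d ℝ :=
  let A21 := A.toBlocks₂₁
  let B2 := B.toRows₂
  let C1 := C.toCols₁
  let C2 := C.toCols₂
  let P2 := X.toBlocks₂₂
  let K := K2 A B X
  C1ᵀ * C1
    - (A21ᵀ * P2 + C1ᵀ * C2) * K⁻¹ᵀ * A21
    - A21ᵀ * K⁻¹ * (C2ᵀ * C1 + P2ᵀ * A21)
    - (C1ᵀ * C2 + A21ᵀ * P2) * K⁻¹ᵀ * B2 * B2ᵀ * K⁻¹ * (C2ᵀ * C1 + P2ᵀ * A21)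

/-- `Ā = M₁₁ - M₁₂ M₂₂⁻¹ M₂₁`, for the closed loop matrix `M`. -/
def Abar (M : Matrix (d ⊕ a) (d ⊕ a) ℝ) : Matrix d d ℝ :=
  M.toBlocks₁₁ - M.toBlocks₁₂ * M.toBlocks₂₂⁻¹ * M.toBlocks₂₁

/-- `B̄ = B₁ - M₁₂ M₂₂⁻¹ B₂`, for the closed loop matrix `M`. -/
def Bbar (M : Matrix (d ⊕ a) (d ⊕ a) ℝ) (B : Matrix (d ⊕ a) μ ℝ) : Matrix d μ ℝ :=
  B.toRows₁ - M.toBlocks₁₂ * M.toBlocks₂₂⁻¹ * B.toRows₂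

/-- The reachability Gramian `∫₀^∞ exp(s G) H H* exp(s G*) ds`, taken entrywise. -/
def gramian (G : Matrix d d ℝ) (H : Matrix d μ ℝ) : Matrix d d ℝ :=
  Matrix.of fun i j =>
    ∫ s in Ioi (0 : ℝ), (NormedSpace.exp (s • G) * H * Hᵀ * NormedSpace.exp (s • Gᵀ)) i j

end Blocks

section Control

variable {ι κ ℓ μ : Type*} [Fintype ι] [DecidableEq ι] [Fintype κ] [Fintype ℓ]
  [Fintype μ] [DecidableEq μ]

/-- The cost functional on `[0, t₁]` with targets `yc`, `ye`. -/
def cost (C : Matrix κ ι ℝ) (F : Matrix ℓ ι ℝ) (yc : EuclideanSpace ℝ κ)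
    (ye : EuclideanSpace ℝ ℓ) (t₁ : ℝ) (x : ℝ → EuclideanSpace ℝ ι)
    (u : ℝ → EuclideanSpace ℝ μ) : ℝ :=
  1 / 2 * (∫ s in (0 : ℝ)..t₁, (‖toEuclideanLin C (x s) - yc‖ ^ 2 + ‖u s‖ ^ 2))
    + 1 / 2 * ‖toEuclideanLin F (x t₁) - ye‖ ^ 2

/-- Square integrable pairs `(x, u)` on `[0, t₁]` that satisfy `E x' = A x + B u`,
`E x(0) = E x₀` in the sense of Carathéodory: `E x` is absolutely continuous and the equation
holds almost everywhere, written in integrated form. -/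
structure IsAdmissible (E A : Matrix ι ι ℝ) (B : Matrix ι μ ℝ) (x₀ : EuclideanSpace ℝ ι)
    (t₁ : ℝ) (x : ℝ → EuclideanSpace ℝ ι) (u : ℝ → EuclideanSpace ℝ μ) : Prop where
  memLp_x : MemLp x 2 (volume.restrict (Icc 0 t₁))
  memLp_u : MemLp u 2 (volume.restrict (Icc 0 t₁))
  dae : ∀ t ∈ Icc 0 t₁, toEuclideanLin E (x t) =
    toEuclideanLin E x₀ + ∫ s in (0 : ℝ)..t, (toEuclideanLin A (x s) + toEuclideanLin B (u s))

/-- Classical solutions of `E x' = A x + B u`, `E x(0) = E x₀` on `[0, t₁]`. -/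
structure IsClassicalSolution (E A : Matrix ι ι ℝ) (B : Matrix ι μ ℝ)
    (x₀ : EuclideanSpace ℝ ι) (t₁ : ℝ) (x : ℝ → EuclideanSpace ℝ ι)
    (u : ℝ → EuclideanSpace ℝ μ) : Prop where
  differentiable : DifferentiableOn ℝ x (Icc 0 t₁)
  continuous : ContinuousOn u (Icc 0 t₁)
  dae : ∀ t ∈ Icc 0 t₁, toEuclideanLin E (derivWithin x (Icc 0 t₁) t) =
    toEuclideanLin A (x t) + toEuclideanLin B (u t)
  initial : toEuclideanLin E (x 0) = toEuclideanLin E x₀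

/-- `(x, u)` solves the finite horizon optimal control problem: it is a classical solution of the
DAE, and it is admissible and has minimal cost among all admissible pairs. -/
structure IsOptimal (E A : Matrix ι ι ℝ) (B : Matrix ι μ ℝ) (C : Matrix κ ι ℝ)
    (F : Matrix ℓ ι ℝ) (yc : EuclideanSpace ℝ κ) (ye : EuclideanSpace ℝ ℓ)
    (x₀ : EuclideanSpace ℝ ι) (t₁ : ℝ) (x : ℝ → EuclideanSpace ℝ ι)
    (u : ℝ → EuclideanSpace ℝ μ) : Prop where
  classical : IsClassicalSolution E A B x₀ t₁ x u
  admissible : IsAdmissible E A B x₀ t₁ x u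
  minimal : ∀ x' u', IsAdmissible E A B x₀ t₁ x' u' →
    cost C F yc ye t₁ x u ≤ cost C F yc ye t₁ x' u'

/-- The two turnpike bounds with rate `σ`, for a family of pairs indexed by the horizon; the
constant does not depend on the horizon. -/
def TurnpikeBounds (x : ℝ → ℝ → EuclideanSpace ℝ ι) (u : ℝ → ℝ → EuclideanSpace ℝ μ)
    (σ : ℝ) : Prop :=
  ∃ c : ℝ, 0 < c ∧ ∀ t₁ : ℝ, 0 < t₁ → ∀ t ∈ Icc 0 t₁,
    ‖x t₁ t‖ ≤ c * (Real.exp (t * σ) + Real.exp ((t₁ - t) * σ)) ∧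
    ‖u t₁ t‖ ≤ c * (Real.exp (t * σ) + Real.exp ((t₁ - t) * σ))

end Control

end DAETurnpike

end

namespace DAETurnpike

section LinftyOpNorm

attribute [local instance] Matrix.linftyOpNormedRing Matrix.linftyOpNormedAlgebra

/-! ### Derivatives of matrix-valued curves and of the matrix exponential. -/

section Calculus

/-! Impulse-freeness makes the lower right block of the closed loop matrix `M = A - B B* P`
invertible, so the algebraic variables can be eliminated. Write the costate of the optimality system
as `P x + ν`, where the Riccati equation absorbs the feedback part. The correction `ν` is determined
by its differential part `l`, and the system becomes triangular: `l' = -Ā* l`, `x' = Ā x - B̄ B̄*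
l`, with end condition `l(t₁) = G x(t₁)`, `G = S - P₁`. Hence `l(t) = exp((t₁ - t) Ā*) z` and `x(t)
= exp(t Ā) x₀ - W_t l(t)`, where `W_t = W - exp(t Ā) W exp(t Ā*)` is the Gramian of horizon `t`. The
two exponentials are the two terms of the turnpike bound.

What remains is to find `z = G x(t₁)` and bound it uniformly in the horizon. The end condition reads
`(1 + W_{t₁} G) x(t₁) = exp(t₁ Ā) x₀`. For finite horizons `1 + W_{t₁} G` is invertible by an energy
argument based on the reduced Riccati equation (`reduced_riccati`) and on the semidefiniteness of
`Q̃` and `S` (`isUnit_one_add_finiteGramian_mul`). Its limit is invertible by assumption, so its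
inverse is bounded on the half-line (`exists_norm_inv_one_add_finiteGramian_mul_le`).

Growth rates of `exp(t Ā)` come from generalized eigenspaces (`exists_norm_exp_smul_le`). The
abscissa is negative because eigenvalues of `Ā` are finite eigenvalues of the pencil
(`spectrum_Abar_subset`). Optimality among all square integrable pairs follows from convexity and
integration by parts against the costate (`cost_le_of_costate`, `isOptimal_of_reduced`). -/

theorem hasDerivAt_matrix_iff {p q 𝕜 : Type*} [Fintype p] [Fintype q] [RCLike 𝕜] {M : ℝ → Matrix p q 𝕜} {M' : Matrix p q 𝕜} {t : ℝ} :
    HasDerivAt M M' t ↔ ∀ i j, HasDerivAt (fun s => M s i j) (M' i j) t := by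
  constructor
  · intro h i j
    exact hasDerivAt_pi.1 (hasDerivAt_pi.1 h i) j
  · intro h
    exact hasDerivAt_pi.2 fun i => hasDerivAt_pi.2 fun j => h i j

variable {p q 𝕜 : Type*} [Fintype p] [Fintype q] [RCLike 𝕜]

theorem HasDerivAt.matrix_mulVec {M : ℝ → Matrix p q 𝕜} {M' : Matrix p q 𝕜} {v : ℝ → q → 𝕜}
    {v' : q → 𝕜} {t : ℝ} (hM : HasDerivAt M M' t) (hv : HasDerivAt v v' t) :
    HasDerivAt (fun s => M s *ᵥ v s) (M' *ᵥ v t + M t *ᵥ v') t := by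
  refine hasDerivAt_pi.2 fun i => ?_
  have := HasDerivAt.fun_sum (u := Finset.univ) fun j _ =>
    (hasDerivAt_matrix_iff.1 hM i j).mul (hasDerivAt_pi.1 hv j)
  simpa [mulVec, dotProduct, Finset.sum_add_distrib] using this

theorem HasDerivAt.const_mulVec (M : Matrix p q 𝕜) {v : ℝ → q → 𝕜}
    {v' : q → 𝕜} {t : ℝ} (hv : HasDerivAt v v' t) :
    HasDerivAt (fun s => M *ᵥ v s) (M *ᵥ v') t := by
  have hM : HasDerivAt (fun _ : ℝ => M) 0 t := hasDerivAt_matrix_iff.2 fun i j => by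
    simpa using hasDerivAt_const t (M i j)
  simpa using HasDerivAt.matrix_mulVec hM hv

theorem HasDerivAt.dotProduct {v w : ℝ → q → ℝ} {v' w' : q → ℝ} {t : ℝ}
    (hv : HasDerivAt v v' t) (hw : HasDerivAt w w' t) :
    HasDerivAt (fun s => v s ⬝ᵥ w s) (v' ⬝ᵥ w t + v t ⬝ᵥ w') t := by
  have := HasDerivAt.fun_sum (u := Finset.univ) fun j _ =>
    (hasDerivAt_pi.1 hv j).mul (hasDerivAt_pi.1 hw j)
  simpa [_root_.dotProduct, Finset.sum_add_distrib] using this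

variable [DecidableEq p]

theorem hasDerivAt_exp_smul (M : Matrix p p 𝕜) (t : ℝ) :
    HasDerivAt (fun s : ℝ => NormedSpace.exp (s • M)) (M * NormedSpace.exp (t • M)) t :=
  hasDerivAt_exp_smul_const' M t

theorem commute_exp_smul (M : Matrix p p 𝕜) (t : ℝ) :
    Commute M (NormedSpace.exp (t • M)) := by
  have h := (hasDerivAt_exp_smul_const (𝕂 := ℝ) M t).unique (hasDerivAt_exp_smul_const' M t)
  exact h.symm

theorem hasDerivAt_exp_smul_mulVec (M : Matrix p p 𝕜) (v : p → 𝕜) (t : ℝ) :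
    HasDerivAt (fun s : ℝ => NormedSpace.exp (s • M) *ᵥ v)
      (NormedSpace.exp (t • M) *ᵥ (M *ᵥ v)) t := by
  have := HasDerivAt.matrix_mulVec (hasDerivAt_exp_smul M t) (hasDerivAt_const t v)
  rw [(commute_exp_smul M t).eq] at this
  simpa using this

end Calculus

/-! ### Growth of the semigroup from the spectrum. -/

section Growth

variable {p : Type*} [Fintype p] [DecidableEq p]

theorem hasDerivAt_cexp_smul_exp_smul_mulVec (M : Matrix p p ℂ) (μ : ℂ) (v : p → ℂ) (t : ℝ) :
    HasDerivAt (fun s : ℝ => Complex.exp (-(s * μ)) • (NormedSpace.exp (s • M) *ᵥ v))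
      (Complex.exp (-(t * μ)) • (NormedSpace.exp (t • M) *ᵥ ((M - μ • 1) *ᵥ v))) t := by
  have h1 : HasDerivAt (fun s : ℝ => Complex.exp (-(s * μ)))
      (Complex.exp (-(t * μ)) * (-(1 * μ))) t :=
    ((((hasDerivAt_id t).ofReal_comp).mul_const μ).neg).cexp
  refine (h1.fun_smul (hasDerivAt_exp_smul_mulVec M v t)).congr_deriv ?_
  simp only [sub_mulVec, smul_mulVec, one_mulVec, mulVec_sub, mulVec_smul, smul_sub, smul_smul]
  module

/-- Differentiating `exp(-tμ) exp(tM) v` replaces `v` by `(M - μ) v`, so induction on `k` and the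
mean value inequality give polynomial growth, which any positive rate `ε` absorbs. -/
theorem exists_bound_of_pow_mulVec_eq_zero (M : Matrix p p ℂ) (μ : ℂ) (k : ℕ) (v : p → ℂ)
    (hv : (M - μ • 1) ^ k *ᵥ v = 0) (ε : ℝ) (hε : 0 < ε) :
    ∃ c : ℝ, 0 ≤ c ∧ ∀ t : ℝ, 0 ≤ t →
      ‖Complex.exp (-(t * μ)) • (NormedSpace.exp (t • M) *ᵥ v)‖ ≤ c * Real.exp (t * ε) := by
  induction k generalizing v ε with
  | zero =>
    refine ⟨0, le_rfl, fun t _ => ?_⟩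
    have : v = 0 := by simpa using hv
    simp [this]
  | succ k ih =>
    -- Half of `ε` serves the induction hypothesis; the other half absorbs the factor `t` from the
    -- mean value inequality.
    obtain ⟨c, hc, hb⟩ := ih ((M - μ • 1) *ᵥ v) (by rwa [mulVec_mulVec, ← pow_succ]) (ε / 2)
      (by positivity)
    refine ⟨‖v‖ + c * (2 / ε), by positivity, fun t ht => ?_⟩
    have hm := norm_image_sub_le_of_norm_deriv_le_segment'
      (f := fun s : ℝ => Complex.exp (-(s * μ)) • (NormedSpace.exp (s • M) *ᵥ v))
      (C := c * Real.exp (t * (ε / 2))) (a := 0) (b := t)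
      (fun s _ => (hasDerivAt_cexp_smul_exp_smul_mulVec M μ v s).hasDerivWithinAt)
      (fun s hs => (hb s hs.1).trans (by gcongr; exact hs.2.le)) t ⟨ht, le_rfl⟩
    have h0 : Complex.exp (-((0 : ℝ) * μ)) • (NormedSpace.exp ((0 : ℝ) • M) *ᵥ v) = v := by
      simp
    rw [h0, sub_zero] at hm
    have h1 : t ≤ 2 / ε * Real.exp (t * (ε / 2)) := by
      have := Real.add_one_le_exp (t * (ε / 2))
      rw [div_mul_eq_mul_div, le_div_iff₀ hε]
      linarith
    have h2 : Real.exp (t * ε) = Real.exp (t * (ε / 2)) * Real.exp (t * (ε / 2)) := by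
      rw [← Real.exp_add]; ring_nf
    have h3 : 1 ≤ Real.exp (t * ε) := Real.one_le_exp (by positivity)
    calc _ ≤ ‖v‖ + c * Real.exp (t * (ε / 2)) * t := by
            have := norm_sub_norm_le
              (Complex.exp (-(t * μ)) • (NormedSpace.exp (t • M) *ᵥ v)) v
            linarith
      _ ≤ ‖v‖ * Real.exp (t * ε)
          + c * Real.exp (t * (ε / 2)) * (2 / ε * Real.exp (t * (ε / 2))) := by
            gcongr
            exact le_mul_of_one_le_right (norm_nonneg _) h3
      _ = _ := by rw [h2]; ring

theorem norm_exp_smul_mulVec_eq_of_eigen (M : Matrix p p ℂ) (μ : ℂ) (v : p → ℂ)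
    (hv : (M - μ • 1) *ᵥ v = 0) (t : ℝ) (ht : 0 ≤ t) :
    Complex.exp (-(t * μ)) • (NormedSpace.exp (t • M) *ᵥ v) = v := by
  have hm := norm_image_sub_le_of_norm_deriv_le_segment'
      (f := fun s : ℝ => Complex.exp (-(s * μ)) • (NormedSpace.exp (s • M) *ᵥ v))
      (C := 0) (a := 0) (b := t)
      (fun s _ => (hasDerivAt_cexp_smul_exp_smul_mulVec M μ v s).hasDerivWithinAt)
      (fun s hs => by simp [hv]) t ⟨ht, le_rfl⟩
  simpa [sub_eq_zero] using hm

/-- Vectors whose orbit under `exp (t M)` grows at most like `exp (t σ)`. -/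
def growthSubmodule (M : Matrix p p ℂ) (σ : ℝ) : Submodule ℂ (p → ℂ) where
  carrier := {v | ∃ c : ℝ, ∀ t : ℝ, 0 ≤ t → ‖NormedSpace.exp (t • M) *ᵥ v‖ ≤ c * Real.exp (t * σ)}
  zero_mem' := ⟨0, fun t _ => by simp⟩
  add_mem' := by
    rintro v w ⟨c, hc⟩ ⟨c', hc'⟩
    refine ⟨c + c', fun t ht => ?_⟩
    rw [mulVec_add, add_mul]
    exact (norm_add_le _ _).trans (add_le_add (hc t ht) (hc' t ht))
  smul_mem' := by
    rintro z v ⟨c, hc⟩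
    refine ⟨‖z‖ * c, fun t ht => ?_⟩
    rw [mulVec_smul, norm_smul, mul_assoc]
    gcongr
    exact hc t ht

theorem norm_cexp_smul {E : Type*} [NormedAddCommGroup E] [NormedSpace ℂ E] (t : ℝ) (μ : ℂ)
    (w : E) : ‖w‖ = ‖Complex.exp (-(t * μ)) • w‖ * Real.exp (t * μ.re) := by
  rw [norm_smul, Complex.norm_exp]
  simp only [Complex.neg_re, Complex.mul_re, Complex.ofReal_re, Complex.ofReal_im, zero_mul,
    sub_zero]
  rw [mul_right_comm, ← Real.exp_add]
  simp

/-- Generalized eigenspaces span over `ℂ`, so it suffices to place each of them in the submodule. -/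
theorem growthSubmodule_eq_top (M : Matrix p p ℂ) (σ : ℝ)
    (h : ∀ μ ∈ spectrum ℂ M, μ.re < σ ∨ (μ.re = σ ∧
      ∀ v : p → ℂ, (M - μ • 1) ^ 2 *ᵥ v = 0 → (M - μ • 1) *ᵥ v = 0)) :
    growthSubmodule M σ = ⊤ := by
  rw [eq_top_iff, ← Module.End.iSup_maxGenEigenspace_eq_top (toLin' M), iSup_le_iff]
  intro μ v hv
  obtain ⟨k, hk⟩ := (Module.End.mem_maxGenEigenspace _ _ _).1 hv
  have hlin : toLin' M - μ • 1 = toLin' (M - μ • 1) := by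
    simp [map_sub, toLin'_one, Module.End.one_eq_id]
  rw [hlin, ← toLin'_pow, toLin'_apply] at hk
  by_cases hv0 : v = 0
  · rw [hv0]; exact zero_mem _
  have hμ : μ ∈ spectrum ℂ M := by
    by_contra hμ
    rw [spectrum.mem_iff, not_not] at hμ
    have hu : IsUnit (M - μ • 1) := by
      rw [← neg_sub, IsUnit.neg_iff]
      simpa [Algebra.algebraMap_eq_smul_one] using hμ
    exact hv0 (mulVec_injective_of_isUnit (hu.pow k) (by simpa using hk))
  rcases h μ hμ with hlt | ⟨heq, hss⟩
  -- The gap `σ - re μ` pays for the polynomial factor of a possible Jordan block.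
  · obtain ⟨c, hc, hb⟩ := exists_bound_of_pow_mulVec_eq_zero M μ k v hk (σ - μ.re) (by linarith)
    refine ⟨c, fun t ht => ?_⟩
    rw [norm_cexp_smul t μ]
    calc _ ≤ c * Real.exp (t * (σ - μ.re)) * Real.exp (t * μ.re) := by
          gcongr; exact hb t ht
      _ = _ := by rw [mul_assoc, ← Real.exp_add]; ring_nf
  -- Semisimplicity collapses all kernels of powers to the eigenspace, where no polynomial factor
  -- arises.
  · have hker : ∀ j : ℕ, ∀ w : p → ℂ, (M - μ • 1) ^ j *ᵥ w = 0 → (M - μ • 1) *ᵥ w = 0 := by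
      intro j
      induction j with
      | zero => intro w hw; simp at hw; simp [hw]
      | succ j ih =>
        intro w hw
        refine hss w ?_
        rw [pow_two, ← mulVec_mulVec]
        refine ih _ ?_
        rwa [mulVec_mulVec, ← pow_succ]
    refine ⟨‖v‖, fun t ht => ?_⟩
    rw [norm_cexp_smul t μ, norm_exp_smul_mulVec_eq_of_eigen M μ v (hker k v hk) t ht, heq]

theorem exists_bound_exp_smul_entry (M : Matrix p p ℂ) (σ : ℝ)
    (h : ∀ μ ∈ spectrum ℂ M, μ.re < σ ∨ (μ.re = σ ∧
      ∀ v : p → ℂ, (M - μ • 1) ^ 2 *ᵥ v = 0 → (M - μ • 1) *ᵥ v = 0)) :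
    ∃ c : ℝ, 0 ≤ c ∧ ∀ t : ℝ, 0 ≤ t → ∀ i j,
      ‖NormedSpace.exp (t • M) i j‖ ≤ c * Real.exp (t * σ) := by
  have hmem : ∀ j : p, ∃ c : ℝ, ∀ t : ℝ, 0 ≤ t →
      ‖NormedSpace.exp (t • M) *ᵥ Pi.single j 1‖ ≤ c * Real.exp (t * σ) := fun j => by
    have : (Pi.single j 1 : p → ℂ) ∈ growthSubmodule M σ := by
      rw [growthSubmodule_eq_top M σ h]; trivial
    exact this
  choose c hc using hmem
  refine ⟨∑ j, |c j|, by positivity, fun t ht i j => ?_⟩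
  have h1 := (norm_le_pi_norm _ i).trans (hc j t ht)
  rw [mulVec_single_one] at h1
  refine h1.trans ?_
  gcongr
  exact (le_abs_self _).trans
    (Finset.single_le_sum (f := fun j => |c j|) (fun _ _ => abs_nonneg _) (Finset.mem_univ j))

theorem toComplex_exp (M : Matrix p p ℝ) (t : ℝ) :
    toComplex (NormedSpace.exp (t • M)) = NormedSpace.exp (t • toComplex M) := by
  have h := NormedSpace.map_exp (Complex.ofRealHom.mapMatrix : Matrix p p ℝ →+* Matrix p p ℂ)
    (by exact continuous_id.matrix_map Complex.continuous_ofReal) (t • M)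
  refine h.trans ?_
  congr 1
  ext i j
  simp [toComplex]

/-- A bound for the semigroup of `M`, from its spectrum. -/
theorem exists_norm_exp_smul_le (M : Matrix p p ℝ) (σ : ℝ)
    (h : ∀ μ ∈ spectrum ℂ (toComplex M), μ.re < σ ∨ (μ.re = σ ∧
      ∀ v : p → ℂ, (toComplex M - μ • 1) ^ 2 *ᵥ v = 0 → (toComplex M - μ • 1) *ᵥ v = 0)) :
    ∃ c : ℝ, 0 ≤ c ∧ ∀ t : ℝ, 0 ≤ t →
      ‖NormedSpace.exp (t • M)‖ ≤ c * Real.exp (t * σ) := by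
  obtain ⟨c, hc, hb⟩ := exists_bound_exp_smul_entry (toComplex M) σ h
  refine ⟨Fintype.card p * c, by positivity, fun t ht => ?_⟩
  have hsum : ∀ i, ∑ j, ‖NormedSpace.exp (t • M) i j‖ ≤ Fintype.card p * c * Real.exp (t * σ) := by
    intro i
    calc _ ≤ ∑ _j : p, c * Real.exp (t * σ) := by
          refine Finset.sum_le_sum fun j _ => ?_
          have := hb t ht i j
          rw [← toComplex_exp] at this
          simpa [toComplex] using this
      _ = _ := by simp [mul_assoc]
  rw [linfty_opNorm_def]
  have : (Finset.univ.sup fun i => ∑ j, ‖NormedSpace.exp (t • M) i j‖₊) ≤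
      Real.toNNReal (Fintype.card p * c * Real.exp (t * σ)) := by
    refine Finset.sup_le fun i _ => ?_
    rw [← NNReal.coe_le_coe, Real.coe_toNNReal _ (by positivity)]
    simpa using hsum i
  have h2 := NNReal.coe_le_coe.2 this
  rwa [Real.coe_toNNReal _ (by positivity)] at h2

end Growth

end LinftyOpNorm

section LinftyOpNorm

attribute [local instance] Matrix.linftyOpNormedRing Matrix.linftyOpNormedAlgebra

/-! ### Infinite and finite horizon Gramians. -/

section Gramian

open Filter Topology

variable {d μ : Type*} [Fintype d] [DecidableEq d] [Fintype μ]

theorem norm_entry_le_linftyOpNorm (M : Matrix d d ℝ) (i j : d) : ‖M i j‖ ≤ ‖M‖ := by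
  rw [linfty_opNorm_def, ← coe_nnnorm, NNReal.coe_le_coe]
  exact (Finset.single_le_sum (f := fun j => ‖M i j‖₊) (fun _ _ => zero_le)
    (Finset.mem_univ j)).trans
    (Finset.le_sup (f := fun i => ∑ j, ‖M i j‖₊) (Finset.mem_univ i))

theorem linftyOpNorm_le_of_entry_le (M : Matrix d d ℝ) {c : ℝ} (hc : 0 ≤ c)
    (h : ∀ i j, ‖M i j‖ ≤ c) : ‖M‖ ≤ Fintype.card d * c := by
  have : (Finset.univ.sup fun i => ∑ j, ‖M i j‖₊) ≤ Real.toNNReal (Fintype.card d * c) := by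
    refine Finset.sup_le fun i _ => ?_
    rw [← NNReal.coe_le_coe, Real.coe_toNNReal _ (by positivity)]
    push_cast
    calc _ ≤ ∑ _j : d, c := Finset.sum_le_sum fun j _ => h i j
      _ = _ := by simp
  rw [linfty_opNorm_def]
  have h2 := NNReal.coe_le_coe.2 this
  rwa [Real.coe_toNNReal _ (by positivity)] at h2

theorem linftyOpNorm_transpose_le (M : Matrix d d ℝ) : ‖Mᵀ‖ ≤ Fintype.card d * ‖M‖ :=
  linftyOpNorm_le_of_entry_le _ (norm_nonneg _) fun i j => norm_entry_le_linftyOpNorm M j i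

theorem norm_mulVec_le_linftyOpNorm_mul (M : Matrix d d ℝ) (v : d → ℝ) : ‖M *ᵥ v‖ ≤ ‖M‖ * ‖v‖ :=
  linfty_opNorm_mulVec M v

theorem norm_exp_smul_transpose_le {A : Matrix d d ℝ} {c σ : ℝ}
    (hA : ∀ t : ℝ, 0 ≤ t → ‖NormedSpace.exp (t • A)‖ ≤ c * Real.exp (t * σ)) (t : ℝ) (ht : 0 ≤ t) :
    ‖NormedSpace.exp (t • Aᵀ)‖ ≤ Fintype.card d * c * Real.exp (t * σ) := by
  rw [← transpose_smul, exp_transpose, mul_assoc]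
  exact (linftyOpNorm_transpose_le _).trans (by gcongr; exact hA t ht)

theorem hasDerivAt_exp_mul_mul_exp (A Q : Matrix d d ℝ) (t : ℝ) :
    HasDerivAt (fun s : ℝ => NormedSpace.exp (s • A) * Q * NormedSpace.exp (s • Aᵀ))
      (A * (NormedSpace.exp (t • A) * Q * NormedSpace.exp (t • Aᵀ)) +
        NormedSpace.exp (t • A) * Q * NormedSpace.exp (t • Aᵀ) * Aᵀ) t := by
  refine (((hasDerivAt_exp_smul A t).mul_const Q).mul (hasDerivAt_exp_smul Aᵀ t)).congr_deriv ?_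
  rw [(commute_exp_smul Aᵀ t).eq]
  noncomm_ring

theorem norm_exp_mul_mul_exp_le {A : Matrix d d ℝ} {c σ : ℝ} (hc : 0 ≤ c)
    (hA : ∀ t : ℝ, 0 ≤ t → ‖NormedSpace.exp (t • A)‖ ≤ c * Real.exp (t * σ))
    (Q : Matrix d d ℝ) (t : ℝ) (ht : 0 ≤ t) :
    ‖NormedSpace.exp (t • A) * Q * NormedSpace.exp (t • Aᵀ)‖ ≤
      c * ‖Q‖ * (Fintype.card d * c) * Real.exp (t * (2 * σ)) := by
  have h2 : Real.exp (t * (2 * σ)) = Real.exp (t * σ) * Real.exp (t * σ) := by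
    rw [← Real.exp_add]; ring_nf
  calc _ ≤ ‖NormedSpace.exp (t • A)‖ * ‖Q‖ * ‖NormedSpace.exp (t • Aᵀ)‖ :=
        (norm_mul_le _ _).trans (by gcongr; exact norm_mul_le _ _)
    _ ≤ c * Real.exp (t * σ) * ‖Q‖ * (Fintype.card d * c * Real.exp (t * σ)) := by
        gcongr
        exacts [hA t ht, norm_exp_smul_transpose_le hA t ht]
    _ = _ := by rw [h2]; ring

theorem tendsto_exp_mul_mul_exp {A : Matrix d d ℝ} {c σ : ℝ} (hc : 0 ≤ c) (hσ : σ < 0)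
    (hA : ∀ t : ℝ, 0 ≤ t → ‖NormedSpace.exp (t • A)‖ ≤ c * Real.exp (t * σ))
    (Q : Matrix d d ℝ) :
    Tendsto (fun t : ℝ => NormedSpace.exp (t • A) * Q * NormedSpace.exp (t • Aᵀ)) atTop (𝓝 0) := by
  refine squeeze_zero_norm' (a := fun t : ℝ => c * ‖Q‖ * (Fintype.card d * c) *
    Real.exp (t * (2 * σ))) ?_ ?_
  · filter_upwards [eventually_ge_atTop 0] with t ht
    exact norm_exp_mul_mul_exp_le hc hA Q t ht
  · rw [← mul_zero (c * ‖Q‖ * (Fintype.card d * c))]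
    refine Tendsto.const_mul _ (Real.tendsto_exp_atBot.comp ?_)
    exact tendsto_id.atTop_mul_const_of_neg (by linarith)

theorem integrableOn_exp_mul_mul_exp_entry {A : Matrix d d ℝ} {c σ : ℝ} (hc : 0 ≤ c) (hσ : σ < 0)
    (hA : ∀ t : ℝ, 0 ≤ t → ‖NormedSpace.exp (t • A)‖ ≤ c * Real.exp (t * σ))
    (Q : Matrix d d ℝ) (i j : d) :
    IntegrableOn (fun t : ℝ => (NormedSpace.exp (t • A) * Q * NormedSpace.exp (t • Aᵀ)) i j)
      (Ioi 0) := by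
  have hcont : Continuous
      (fun t : ℝ => (NormedSpace.exp (t • A) * Q * NormedSpace.exp (t • Aᵀ)) i j) :=
    continuous_iff_continuousAt.2 fun t =>
      (hasDerivAt_matrix_iff.1 (hasDerivAt_exp_mul_mul_exp A Q t) i j).continuousAt
  have hint : IntegrableOn (fun t : ℝ => c * ‖Q‖ * (Fintype.card d * c) *
      Real.exp (2 * σ * t)) (Ioi 0) :=
    (integrableOn_exp_mul_Ioi (by linarith) 0).const_mul _
  refine hint.mono' hcont.aestronglyMeasurable ?_
  refine (ae_restrict_mem measurableSet_Ioi).mono fun t ht => ?_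
  rw [mul_comm (2 * σ)]
  exact (norm_entry_le_linftyOpNorm _ i j).trans (norm_exp_mul_mul_exp_le hc hA Q t (le_of_lt ht))

/-- The Lyapunov equation of the Gramian of a stable matrix. -/
theorem gramian_lyapunov {A : Matrix d d ℝ} {c σ : ℝ} (hc : 0 ≤ c) (hσ : σ < 0)
    (hA : ∀ t : ℝ, 0 ≤ t → ‖NormedSpace.exp (t • A)‖ ≤ c * Real.exp (t * σ))
    (B : Matrix d μ ℝ) :
    A * gramian A B + gramian A B * Aᵀ = -(B * Bᵀ) := by
  ext i j
  set Φ : ℝ → Matrix d d ℝ :=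
    fun t => NormedSpace.exp (t • A) * (B * Bᵀ) * NormedSpace.exp (t • Aᵀ) with hΦ
  have hW : ∀ i j, gramian A B i j = ∫ s in Ioi (0 : ℝ), Φ s i j := fun i j => by
    simp only [gramian, of_apply, hΦ, Matrix.mul_assoc]
  have hint := integrableOn_exp_mul_mul_exp_entry hc hσ hA (B * Bᵀ)
  have hl : ∀ k, IntegrableOn (fun s => A i k * Φ s k j) (Ioi 0) := fun k => (hint k j).const_mul _
  have hr : ∀ k, IntegrableOn (fun s => Φ s i k * Aᵀ k j) (Ioi 0) := fun k =>
    (hint i k).mul_const _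
  -- The Lyapunov expression is the integral of `Φ'` over the half-line, with `Φ 0 = B B*` and `Φ →
  -- 0` at infinity.
  have hFTC := integral_Ioi_of_hasDerivAt_of_tendsto' (a := (0 : ℝ))
    (f := fun t => Φ t i j) (f' := fun t => ∑ k, A i k * Φ t k j + ∑ k, Φ t i k * Aᵀ k j) (m := 0)
    (fun t _ => (hasDerivAt_matrix_iff.1 (hasDerivAt_exp_mul_mul_exp A (B * Bᵀ) t) i j))
    ((integrable_finsetSum _ fun k _ => hl k).add (integrable_finsetSum _ fun k _ => hr k))
    (((tendsto_exp_mul_mul_exp hc hσ hA (B * Bᵀ)).apply_nhds i).apply_nhds j)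
  rw [integral_add (integrable_finsetSum _ fun k _ => hl k)
    (integrable_finsetSum _ fun k _ => hr k), integral_finsetSum _ fun k _ => hl k,
    integral_finsetSum _ fun k _ => hr k] at hFTC
  simp only [integral_const_mul, integral_mul_const, ← hW] at hFTC
  have hΦ0 : Φ 0 = B * Bᵀ := by simp [hΦ]
  rw [hΦ0, zero_sub] at hFTC
  exact hFTC

/-- The reachability Gramian of the horizon `t`, expressed by the infinite horizon one. -/
noncomputable def finiteGramian (A : Matrix d d ℝ) (B : Matrix d μ ℝ) (t : ℝ) : Matrix d d ℝ :=
  gramian A B - NormedSpace.exp (t • A) * gramian A B * NormedSpace.exp (t • Aᵀ)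

theorem finiteGramian_zero (A : Matrix d d ℝ) (B : Matrix d μ ℝ) : finiteGramian A B 0 = 0 := by
  simp [finiteGramian]

theorem hasDerivAt_finiteGramian {A : Matrix d d ℝ} {B : Matrix d μ ℝ}
    (hW : A * gramian A B + gramian A B * Aᵀ = -(B * Bᵀ)) (t : ℝ) :
    HasDerivAt (finiteGramian A B)
      (A * finiteGramian A B t + finiteGramian A B t * Aᵀ + B * Bᵀ) t := by
  refine ((hasDerivAt_exp_mul_mul_exp A (gramian A B) t).const_sub (gramian A B)).congr_deriv ?_
  have : B * Bᵀ = -(A * gramian A B + gramian A B * Aᵀ) := by rw [hW, neg_neg]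
  rw [this, finiteGramian]
  noncomm_ring

theorem continuous_finiteGramian (A : Matrix d d ℝ) (B : Matrix d μ ℝ) :
    Continuous (finiteGramian A B) :=
  continuous_iff_continuousAt.2 fun t =>
    ((hasDerivAt_exp_mul_mul_exp A (gramian A B) t).const_sub (gramian A B)).continuousAt

theorem tendsto_finiteGramian {A : Matrix d d ℝ} {c σ : ℝ} (hc : 0 ≤ c) (hσ : σ < 0)
    (hA : ∀ t : ℝ, 0 ≤ t → ‖NormedSpace.exp (t • A)‖ ≤ c * Real.exp (t * σ))
    (B : Matrix d μ ℝ) :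
    Tendsto (finiteGramian A B) atTop (𝓝 (gramian A B)) := by
  have h := (tendsto_exp_mul_mul_exp hc hσ hA (gramian A B)).const_sub (gramian A B)
  rwa [sub_zero] at h

theorem exists_norm_le_of_continuous_of_tendsto {E : Type*} [NormedAddCommGroup E] {f : ℝ → E}
    {l : E} (hf : ContinuousOn f (Ici 0)) (hl : Tendsto f atTop (𝓝 l)) :
    ∃ c : ℝ, 0 ≤ c ∧ ∀ t : ℝ, 0 ≤ t → ‖f t‖ ≤ c := by
  obtain ⟨T, hT⟩ := eventually_atTop.1 (hl.norm.eventually (gt_mem_nhds (lt_add_one ‖l‖)))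
  obtain ⟨C, hC⟩ := (isCompact_Icc (a := (0 : ℝ)) (b := T)).exists_bound_of_continuousOn
    (hf.mono Icc_subset_Ici_self)
  refine ⟨max (‖l‖ + 1) C, le_max_of_le_left (by positivity), fun t ht => ?_⟩
  rcases le_total T t with h | h
  · exact (hT t h).le.trans (le_max_left _ _)
  · exact (hC t ⟨ht, h⟩).trans (le_max_right _ _)

/-- Inversion is continuous at invertible matrices, so the inverse is a continuous function on the
closed half-line with a limit at infinity, hence bounded. This makes the turnpike constant
independent of the horizon. -/
theorem exists_norm_inv_one_add_finiteGramian_mul_le {A : Matrix d d ℝ} {c σ : ℝ} (hc : 0 ≤ c)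
    (hσ : σ < 0) (hA : ∀ t : ℝ, 0 ≤ t → ‖NormedSpace.exp (t • A)‖ ≤ c * Real.exp (t * σ))
    (B : Matrix d μ ℝ) (G : Matrix d d ℝ) (hinf : IsUnit (1 + gramian A B * G))
    (hfin : ∀ t : ℝ, 0 < t → IsUnit (1 + finiteGramian A B t * G)) :
    ∃ K : ℝ, 0 ≤ K ∧ ∀ t : ℝ, 0 ≤ t → ‖(1 + finiteGramian A B t * G)⁻¹‖ ≤ K := by
  have hcont : ∀ M : Matrix d d ℝ, IsUnit M → ContinuousAt (fun M : Matrix d d ℝ => M⁻¹) M := by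
    rintro _ ⟨U, rfl⟩
    simp only [nonsing_inv_eq_ringInverse]
    exact NormedRing.inverse_continuousAt U
  have hg : Continuous fun t => 1 + finiteGramian A B t * G :=
    continuous_const.add ((continuous_finiteGramian A B).mul continuous_const)
  refine exists_norm_le_of_continuous_of_tendsto (l := (1 + gramian A B * G)⁻¹) ?_ ?_
  · intro t ht
    -- At `t = 0` the finite Gramian vanishes and the matrix is `1`, so boundedness reaches down to
    -- arbitrarily short horizons.
    have hu : IsUnit (1 + finiteGramian A B t * G) := by
      rcases eq_or_lt_of_le (show (0 : ℝ) ≤ t from ht) with rfl | h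
      · simp [finiteGramian_zero]
      · exact hfin t h
    exact ((hcont _ hu).comp (f := fun t => 1 + finiteGramian A B t * G)
      hg.continuousAt).continuousWithinAt
  · exact (hcont _ hinf).tendsto.comp
      (((tendsto_finiteGramian hc hσ hA B).mul_const G).const_add 1)

end Gramian

/-! ### Explicit trajectories of the reduced Hamiltonian system and its solvability. -/

section ReducedTrajectories

variable {d μ : Type*} [Fintype d] [DecidableEq d] [Fintype μ]

/-- The adjoint variable `exp((t₁ - t) A*) z`. -/
noncomputable def costate (A : Matrix d d ℝ) (t₁ : ℝ) (z : d → ℝ) (t : ℝ) : d → ℝ :=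
  NormedSpace.exp ((t₁ - t) • Aᵀ) *ᵥ z

/-- The trajectory of `x' = A x - B B* λ` from `x₀`, for the costate `λ` with end value `z`. -/
noncomputable def reducedState (A : Matrix d d ℝ) (B : Matrix d μ ℝ) (t₁ : ℝ) (x₀ z : d → ℝ) (t : ℝ) : d → ℝ :=
  NormedSpace.exp (t • A) *ᵥ x₀ - finiteGramian A B t *ᵥ costate A t₁ z t

theorem hasDerivAt_costate (A : Matrix d d ℝ) (t₁ : ℝ) (z : d → ℝ) (t : ℝ) :
    HasDerivAt (costate A t₁ z) (-(Aᵀ *ᵥ costate A t₁ z t)) t := by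
  have h := (hasDerivAt_exp_smul_mulVec Aᵀ z (t₁ - t)).scomp t ((hasDerivAt_id t).const_sub t₁)
  refine h.congr_deriv ?_
  rw [costate, mulVec_mulVec, mulVec_mulVec, (commute_exp_smul Aᵀ (t₁ - t)).eq]
  simp

/-- The term `W_t A* l` from the differential equation of `W_t` cancels against `W_t l'`, leaving `A
W_t l + B B* l`. -/
theorem hasDerivAt_reducedState {A : Matrix d d ℝ} {B : Matrix d μ ℝ}
    (hW : A * gramian A B + gramian A B * Aᵀ = -(B * Bᵀ)) (t₁ : ℝ) (x₀ z : d → ℝ) (t : ℝ) :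
    HasDerivAt (reducedState A B t₁ x₀ z)
      (A *ᵥ reducedState A B t₁ x₀ z t - B *ᵥ (Bᵀ *ᵥ costate A t₁ z t)) t := by
  refine ((hasDerivAt_exp_smul_mulVec A x₀ t).sub
    (HasDerivAt.matrix_mulVec (hasDerivAt_finiteGramian hW t)
      (hasDerivAt_costate A t₁ z t))).congr_deriv ?_
  rw [mulVec_mulVec, ← (commute_exp_smul A t).eq]
  simp only [reducedState, mulVec_sub, add_mulVec, mulVec_neg, mulVec_mulVec]
  abel

theorem reducedState_zero (A : Matrix d d ℝ) (B : Matrix d μ ℝ) (t₁ : ℝ) (x₀ z : d → ℝ) :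
    reducedState A B t₁ x₀ z 0 = x₀ := by
  simp [reducedState, finiteGramian_zero]

theorem costate_self (A : Matrix d d ℝ) (t₁ : ℝ) (z : d → ℝ) : costate A t₁ z t₁ = z := by
  simp [costate]

theorem reducedState_self (A : Matrix d d ℝ) (B : Matrix d μ ℝ) (t₁ : ℝ) (x₀ z : d → ℝ) :
    reducedState A B t₁ x₀ z t₁ = NormedSpace.exp (t₁ • A) *ᵥ x₀ - finiteGramian A B t₁ *ᵥ z := by
  rw [reducedState, costate_self]

/-- The integrating factor `exp(-sM)` makes the curve constant. -/
theorem eq_zero_of_hasDerivAt_mulVec (M : Matrix d d ℝ) {t₁ : ℝ} {x : ℝ → d → ℝ}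
    (hx : ∀ t ∈ Icc 0 t₁, HasDerivAt x (M *ᵥ x t) t) (h0 : x 0 = 0) (t : ℝ) (ht : t ∈ Icc 0 t₁) :
    x t = 0 := by
  have hd : ∀ s ∈ Icc 0 t₁,
      HasDerivAt (fun s => NormedSpace.exp (s • -M) *ᵥ x s) 0 s := fun s hs => by
    refine (HasDerivAt.matrix_mulVec (hasDerivAt_exp_smul (-M) s) (hx s hs)).congr_deriv ?_
    rw [(commute_exp_smul (-M) s).eq, mulVec_mulVec, ← add_mulVec]
    simp
  have h := constant_of_has_deriv_right_zero
    (fun s hs => (hd s hs).continuousAt.continuousWithinAt)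
    (fun s hs => (hd s ⟨hs.1, hs.2.le⟩).hasDerivWithinAt) t ht
  rw [h0, mulVec_zero] at h
  exact mulVec_injective_of_isUnit (isUnit_exp (t • -M)) (by simpa using h)

/-- Solvability of the finite horizon boundary value problem. -/
theorem isUnit_one_add_finiteGramian_mul {A : Matrix d d ℝ} {B : Matrix d μ ℝ}
    (hW : A * gramian A B + gramian A B * Aᵀ = -(B * Bᵀ)) {X Q S : Matrix d d ℝ}
    (hX : Xᵀ = X) (hQ : ∀ v, 0 ≤ v ⬝ᵥ Q *ᵥ v) (hS : ∀ v, 0 ≤ v ⬝ᵥ S *ᵥ v)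
    (hric : Aᵀ * X + X * A + X * B * Bᵀ * X + Q = 0) {t₁ : ℝ} (ht₁ : 0 < t₁) :
    IsUnit (1 + finiteGramian A B t₁ * (S - X)) := by
  rw [← mulVec_injective_iff_isUnit]
  refine (injective_iff_map_eq_zero
    (1 + finiteGramian A B t₁ * (S - X)).mulVecLin).2 fun y hy => ?_
  rw [mulVecLin_apply, add_mulVec, one_mulVec, ← mulVec_mulVec] at hy
  -- A kernel vector `y` is the end value of a solution of the homogeneous boundary value problem,
  -- starting at `0`; such a solution is shown to vanish.
  set z := (S - X) *ᵥ y with hz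
  set l := costate A t₁ z
  set x := reducedState A B t₁ 0 z
  have hl : ∀ t, HasDerivAt l (-(Aᵀ *ᵥ l t)) t := hasDerivAt_costate A t₁ z
  have hx : ∀ t, HasDerivAt x (A *ᵥ x t - B *ᵥ (Bᵀ *ᵥ l t)) t :=
    hasDerivAt_reducedState hW t₁ 0 z
  have hx0 : x 0 = 0 := reducedState_zero A B t₁ 0 z
  have hx1 : x t₁ = y := by
    rw [show x t₁ = _ from reducedState_self A B t₁ 0 z, mulVec_zero, zero_sub]
    exact (eq_neg_of_add_eq_zero_left hy).symm
  set φ : ℝ → ℝ := fun t => (l t + X *ᵥ x t) ⬝ᵥ x t with hφdef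
  -- The Riccati equation turns the derivative of this pairing into minus a sum of two nonnegative
  -- terms.
  have hφ : ∀ t, HasDerivAt φ (-(x t ⬝ᵥ Q *ᵥ x t) -
      (Bᵀ *ᵥ (l t + X *ᵥ x t)) ⬝ᵥ (Bᵀ *ᵥ (l t + X *ᵥ x t))) t := fun t => by
    refine (HasDerivAt.dotProduct ((hl t).fun_add (HasDerivAt.const_mulVec X (hx t)))
      (hx t)).congr_deriv ?_
    have e1 : ∀ v w : d → ℝ, (Aᵀ *ᵥ v) ⬝ᵥ w = v ⬝ᵥ (A *ᵥ w) := fun v w => by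
      rw [mulVec_transpose, dotProduct_mulVec]
    have e2 : ∀ v w : d → ℝ, (X *ᵥ v) ⬝ᵥ w = v ⬝ᵥ (X *ᵥ w) := fun v w => by
      rw [dotProduct_mulVec, ← mulVec_transpose, hX]
    have e3 : ∀ (v : d → ℝ) (w : μ → ℝ), v ⬝ᵥ (B *ᵥ w) = (Bᵀ *ᵥ v) ⬝ᵥ w := fun v w => by
      rw [mulVec_transpose, dotProduct_mulVec]
    have e4 : (X *ᵥ x t) ⬝ᵥ (A *ᵥ x t) + (X *ᵥ x t) ⬝ᵥ (A *ᵥ x t) +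
        (Bᵀ *ᵥ (X *ᵥ x t)) ⬝ᵥ (Bᵀ *ᵥ (X *ᵥ x t)) + x t ⬝ᵥ Q *ᵥ x t = 0 := by
      have := congrArg (fun M => x t ⬝ᵥ M *ᵥ x t) hric
      simp only [add_mulVec, dotProduct_add, ← mulVec_mulVec, zero_mulVec, dotProduct_zero] at this
      rwa [dotProduct_comm (x t) (Aᵀ *ᵥ _), e1, ← e2 (x t) (A *ᵥ x t), ← e2 (x t) (B *ᵥ _),
        e3] at this
    simp only [add_dotProduct, dotProduct_add, mulVec_add, mulVec_sub, sub_dotProduct,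
      dotProduct_sub, neg_dotProduct, e1, e3]
    rw [e2 (A *ᵥ x t), e2 (B *ᵥ _), dotProduct_comm (A *ᵥ x t) (X *ᵥ x t),
      dotProduct_comm (B *ᵥ _), e3, dotProduct_comm (Bᵀ *ᵥ l t) (Bᵀ *ᵥ (X *ᵥ x t))]
    linarith
  have hφ' : ∀ t, -(x t ⬝ᵥ Q *ᵥ x t) -
      (Bᵀ *ᵥ (l t + X *ᵥ x t)) ⬝ᵥ (Bᵀ *ᵥ (l t + X *ᵥ x t)) ≤ 0 := fun t => by
    have h1 := hQ (x t)
    have h2 : 0 ≤ (Bᵀ *ᵥ (l t + X *ᵥ x t)) ⬝ᵥ (Bᵀ *ᵥ (l t + X *ᵥ x t)) := by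
      simpa using dotProduct_star_self_nonneg (Bᵀ *ᵥ (l t + X *ᵥ x t))
    linarith
  have hanti : Antitone φ := antitone_of_hasDerivAt_nonpos hφ hφ'
  have hφ0 : φ 0 = 0 := by simp [hφdef, hx0]
  have hφ1 : 0 ≤ φ t₁ := by
    have : φ t₁ = y ⬝ᵥ S *ᵥ y := by
      simp only [hφdef, hx1]
      rw [show l t₁ = z from costate_self A t₁ z, hz, ← add_mulVec, sub_add_cancel,
        dotProduct_comm]
    rw [this]; exact hS y
  -- `φ` decreases from `0` to `y · S y ≥ 0`, so it vanishes throughout. Its derivative then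
  -- vanishes too, which forces `B* (l + X x) = 0` and leaves a linear homogeneous equation for `x`.
  have hφeq : ∀ t ∈ Icc 0 t₁, φ t = 0 := fun t ht =>
    le_antisymm (hφ0 ▸ hanti ht.1) (hφ1.trans (hanti ht.2))
  have hw : ∀ t ∈ Icc 0 t₁, Bᵀ *ᵥ (l t + X *ᵥ x t) = 0 := fun t ht => by
    have h0 := (uniqueDiffOn_Icc ht₁ t ht).eq_deriv _ (hφ t).hasDerivWithinAt
      ((hasDerivWithinAt_const t (Icc 0 t₁) (0 : ℝ)).congr hφeq (hφeq t ht))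
    have h1 := hQ (x t)
    have h2 : 0 ≤ (Bᵀ *ᵥ (l t + X *ᵥ x t)) ⬝ᵥ (Bᵀ *ᵥ (l t + X *ᵥ x t)) := by
      simpa using dotProduct_star_self_nonneg (Bᵀ *ᵥ (l t + X *ᵥ x t))
    exact dotProduct_self_eq_zero.1 (by linarith)
  rw [← hx1]
  refine eq_zero_of_hasDerivAt_mulVec (A + B * Bᵀ * X) (fun t ht => ?_) hx0 t₁ ⟨ht₁.le, le_rfl⟩
  refine (hx t).congr_deriv ?_
  have h := hw t ht
  rw [mulVec_add] at h
  rw [eq_neg_of_add_eq_zero_left h, mulVec_neg, sub_neg_eq_add, add_mulVec]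
  simp only [mulVec_mulVec, Matrix.mul_assoc]

end ReducedTrajectories

end LinftyOpNorm

/-! ### Structure of the closed loop pencil. -/

section Structure

variable {d a : Type*} [Fintype d] [DecidableEq d] [Fintype a] [DecidableEq a]

/-- The rank condition bounds the kernel of `[E 0; M E]` by the number of algebraic variables. A
nonzero `y` in the kernel of the lower right block would add one dimension: the vectors `(0, r y, -r
M₁₂ y, p)` lie in that kernel for all `p` and `r`. -/
theorem isUnit_toBlocks₂₂_of_isImpulseFree {M : Matrix (d ⊕ a) (d ⊕ a) ℝ}
    (h : IsImpulseFree (fromBlocks 1 0 0 0) M) : IsUnit M.toBlocks₂₂ := by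
  set E : Matrix (d ⊕ a) (d ⊕ a) ℝ := fromBlocks 1 0 0 0 with hE
  set T := (fromBlocks E 0 M E).mulVecLin with hT
  have hrank : Fintype.card d ≤ E.rank := by
    have h1 := rank_submatrix_le E (Sum.inl : d → d ⊕ a) (Sum.inl : d → d ⊕ a)
    have h2 : E.submatrix (Sum.inl : d → d ⊕ a) (Sum.inl : d → d ⊕ a) = 1 := by
      ext i j; simp [hE, Matrix.one_apply]
    rwa [h2, rank_one] at h1
  have hker : Module.finrank ℝ (LinearMap.ker T) ≤ Fintype.card a := by
    have h1 := LinearMap.finrank_range_add_finrank_ker T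
    have h2 : Module.finrank ℝ (LinearMap.range T) = (fromBlocks E 0 M E).rank := rfl
    rw [h2, h.2] at h1
    simp only [Module.finrank_fintype_fun_eq_card, Fintype.card_sum] at h1
    omega
  rw [← mulVec_injective_iff_isUnit]
  refine (injective_iff_map_eq_zero M.toBlocks₂₂.mulVecLin).2 fun y hy => ?_
  rw [mulVecLin_apply] at hy
  by_contra hy0
  have hmem : ∀ p : a → ℝ, ∀ r : ℝ,
      Sum.elim (Sum.elim (0 : d → ℝ) (r • y)) (Sum.elim (-(r • (M.toBlocks₁₂ *ᵥ y))) p) ∈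
        LinearMap.ker T := fun p r => by
    rw [LinearMap.mem_ker, hT, mulVecLin_apply, fromBlocks_mulVec]
    have hM : M *ᵥ Sum.elim (0 : d → ℝ) (r • y) = Sum.elim (r • (M.toBlocks₁₂ *ᵥ y)) 0 := by
      conv_lhs => rw [← fromBlocks_toBlocks M]
      rw [fromBlocks_mulVec]
      simp [mulVec_smul, hy]
    simp only [Sum.elim_comp_inl, Sum.elim_comp_inr]
    rw [hM, hE, fromBlocks_mulVec, fromBlocks_mulVec]
    ext ((i | i) | (i | i)) <;> simp
  let L : (a → ℝ) × ℝ →ₗ[ℝ] LinearMap.ker T :=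
    LinearMap.codRestrict _
      { toFun := fun q =>
          Sum.elim (Sum.elim (0 : d → ℝ) (q.2 • y)) (Sum.elim (-(q.2 • (M.toBlocks₁₂ *ᵥ y))) q.1)
        map_add' := fun q q' => by
          ext ((i | i) | (i | i)) <;> simp [add_mul]; ring
        map_smul' := fun c q => by
          ext ((i | i) | (i | i)) <;> simp [mul_assoc] }
      (fun q => hmem q.1 q.2)
  have hinj : Function.Injective L := by
    refine (injective_iff_map_eq_zero L).2 ?_
    rintro ⟨p, r⟩ hq
    have hq' := congrArg Subtype.val hq
    have h1 : r • y = 0 := by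
      ext i
      exact congrFun hq' (Sum.inl (Sum.inr i))
    have h2 : p = 0 := by
      ext i
      exact congrFun hq' (Sum.inr (Sum.inr i))
    rw [h2, (smul_eq_zero.1 h1).resolve_right hy0]
    rfl
  have hdim := LinearMap.finrank_le_finrank_of_injective hinj
  rw [Module.finrank_prod, Module.finrank_fintype_fun_eq_card, Module.finrank_self] at hdim
  omega

theorem eq_zero_of_eq_smul_isNilpotent {q : Type*} [Fintype q] [DecidableEq q]
    {N : Matrix q q ℂ} (hN : IsNilpotent N) {μ : ℂ} {z : q → ℂ} (h : z = μ • (N *ᵥ z)) : z = 0 := by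
  obtain ⟨k, hk⟩ := hN
  have : ∀ j : ℕ, z = μ ^ j • (N ^ j *ᵥ z) := by
    intro j
    induction j with
    | zero => simp
    | succ j ih =>
      conv_lhs => rw [ih, h]
      rw [mulVec_smul, smul_smul, mulVec_mulVec, ← pow_succ, ← pow_succ]
  rw [this k, hk, zero_mulVec, smul_zero]

theorem mem_spectrum_iff_exists_mulVec {p : Type*} [Fintype p] [DecidableEq p]
    {M : Matrix p p ℂ} {μ : ℂ} :
    μ ∈ spectrum ℂ M ↔ ∃ v : p → ℂ, v ≠ 0 ∧ M *ᵥ v = μ • v := by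
  rw [spectrum.mem_iff, isUnit_iff_isUnit_det, isUnit_iff_ne_zero, not_not,
    ← exists_mulVec_eq_zero_iff]
  refine exists_congr fun v => and_congr_right fun _ => ?_
  rw [sub_mulVec, Algebra.algebraMap_eq_smul_one, smul_mulVec, one_mulVec, sub_eq_zero, eq_comm]

/-- In decoupled coordinates the fast component satisfies `z = μ N z` with `N` nilpotent, so it is
zero and the slow component is an eigenvector of `J`. -/
theorem mem_spectrum_J_of_pencil {E M : Matrix (d ⊕ a) (d ⊕ a) ℝ} (W : DecoupledForm E M) {μ : ℂ}
    {x : d ⊕ a → ℂ} (hx : x ≠ 0) (h : toComplex M *ᵥ x = μ • (toComplex E *ᵥ x)) :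
    μ ∈ spectrum ℂ W.J := by
  obtain ⟨w, rfl⟩ : ∃ w, W.R *ᵥ w = x :=
    (mulVec_surjective_iff_isUnit.2 W.isUnit_R) x
  have hw : w ≠ 0 := fun hw => hx (by rw [hw, mulVec_zero])
  have h1 : (W.L * toComplex M * W.R) *ᵥ w = μ • ((W.L * toComplex E * W.R) *ᵥ w) := by
    rw [← mulVec_mulVec, ← mulVec_mulVec, h, mulVec_smul, mulVec_mulVec, mulVec_mulVec,
      Matrix.mul_assoc]
  rw [W.transform_A, W.transform_E, submatrix_mulVec_equiv, submatrix_mulVec_equiv] at h1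
  set z := w ∘ W.e.symm with hz
  have h2 : fromBlocks W.J 0 0 1 *ᵥ z = μ • (fromBlocks 1 0 0 W.N *ᵥ z) := by
    ext i
    have := congrFun h1 (W.e.symm i)
    simpa using this
  rw [fromBlocks_mulVec, fromBlocks_mulVec] at h2
  have h3 : W.J *ᵥ (z ∘ Sum.inl) = μ • (z ∘ Sum.inl) := by
    ext i; simpa using congrFun h2 (Sum.inl i)
  have h4 : z ∘ Sum.inr = μ • (W.N *ᵥ (z ∘ Sum.inr)) := by
    ext i; simpa using congrFun h2 (Sum.inr i)
  refine mem_spectrum_iff_exists_mulVec.2 ⟨z ∘ Sum.inl, fun h5 => hw ?_, h3⟩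
  have h6 := eq_zero_of_eq_smul_isNilpotent W.nilpotent_N h4
  ext i
  have : z (W.e i) = 0 := by
    rcases hi : W.e i with j | j
    · exact congrFun h5 j
    · exact congrFun h6 j
  simpa [hz] using this

theorem toComplex_mul {p q r : Type*} [Fintype q] (M : Matrix p q ℝ) (N : Matrix q r ℝ) :
    toComplex (M * N) = toComplex M * toComplex N :=
  Matrix.map_mul (f := Complex.ofRealHom)

theorem spectrum_Abar_subset {M : Matrix (d ⊕ a) (d ⊕ a) ℝ} (hM : IsUnit M.toBlocks₂₂)
    (W : DecoupledForm (fromBlocks 1 0 0 0) M) :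
    spectrum ℂ (toComplex (Abar M)) ⊆ spectrum ℂ W.J := by
  intro μ hμ
  obtain ⟨v, hv, hv'⟩ := mem_spectrum_iff_exists_mulVec.1 hμ
  -- The algebraic part is chosen to satisfy the second block row, making `(v, w)` an eigenvector of
  -- the pencil.
  set w : a → ℂ := -(toComplex (M.toBlocks₂₂⁻¹ * M.toBlocks₂₁) *ᵥ v) with hw
  have hx : (Sum.elim v w : d ⊕ a → ℂ) ≠ 0 := fun h => hv (by
    ext i; exact congrFun h (Sum.inl i))
  refine mem_spectrum_J_of_pencil W hx ?_
  have hMb : toComplex M = fromBlocks (toComplex M.toBlocks₁₁) (toComplex M.toBlocks₁₂)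
      (toComplex M.toBlocks₂₁) (toComplex M.toBlocks₂₂) := by
    ext (i | i) (j | j) <;> rfl
  have hEb : toComplex (fromBlocks 1 0 0 0 : Matrix (d ⊕ a) (d ⊕ a) ℝ) = fromBlocks 1 0 0 0 := by
    ext (i | i) (j | j) <;> simp [toComplex, Matrix.one_apply, apply_ite]
  have h1 : toComplex M.toBlocks₁₁ *ᵥ v + toComplex M.toBlocks₁₂ *ᵥ w = μ • v := by
    rw [← hv', hw, mulVec_neg, mulVec_mulVec, ← toComplex_mul, ← sub_eq_add_neg, ← sub_mulVec,
      Abar, Matrix.mul_assoc]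
    congr 1
    ext i j; simp [toComplex]
  have h2 : toComplex M.toBlocks₂₁ *ᵥ v + toComplex M.toBlocks₂₂ *ᵥ w = 0 := by
    rw [hw, mulVec_neg, mulVec_mulVec, ← toComplex_mul, ← Matrix.mul_assoc,
      mul_nonsing_inv _ ((isUnit_iff_isUnit_det _).1 hM), Matrix.one_mul, add_neg_cancel]
  rw [hMb, hEb, fromBlocks_mulVec, fromBlocks_mulVec]
  simp only [Sum.elim_comp_inl, Sum.elim_comp_inr, h1, h2]
  ext (i | i) <;> simp

theorem spectrum_toComplex_nonempty_finite [Nonempty d] (M : Matrix d d ℝ) :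
    (spectrum ℂ (toComplex M)).Nonempty ∧ (spectrum ℂ (toComplex M)).Finite :=
  ⟨spectrum.nonempty_of_isAlgClosed_of_finiteDimensional ℂ (toComplex M),
    Matrix.finite_spectrum (toComplex M)⟩

theorem re_le_spectralAbscissa {M : Matrix d d ℝ} {μ : ℂ} (hμ : μ ∈ spectrum ℂ (toComplex M)) :
    μ.re ≤ spectralAbscissa M :=
  le_csSup ((Matrix.finite_spectrum (toComplex M)).image _).bddAbove ⟨μ, hμ, rfl⟩

theorem spectralAbscissa_neg [Nonempty d] {M : Matrix d d ℝ}
    (h : ∀ μ ∈ spectrum ℂ (toComplex M), μ.re < 0) : spectralAbscissa M < 0 := by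
  obtain ⟨hne, hfin⟩ := spectrum_toComplex_nonempty_finite M
  obtain ⟨μ, hμ, he⟩ := (hne.image Complex.re).csSup_mem (hfin.image _)
  rw [spectralAbscissa, ← he]
  exact h μ hμ

end Structure

/-! ### Block form of the Riccati equation. -/

section Reduction

theorem fromBlocks_toRows_mul_transpose {d a μ : Type*} [Fintype μ] (B : Matrix (d ⊕ a) μ ℝ) :
    B * Bᵀ = fromBlocks (B.toRows₁ * B.toRows₁ᵀ) (B.toRows₁ * B.toRows₂ᵀ)
      (B.toRows₂ * B.toRows₁ᵀ) (B.toRows₂ * B.toRows₂ᵀ) := by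
  ext (i | i) (j | j) <;> simp [Matrix.mul_apply, toRows₁, toRows₂]

theorem transpose_mul_eq_fromBlocks_toCols {d a κ : Type*} [Fintype κ] (C : Matrix κ (d ⊕ a) ℝ) :
    Cᵀ * C = fromBlocks (C.toCols₁ᵀ * C.toCols₁) (C.toCols₁ᵀ * C.toCols₂)
      (C.toCols₂ᵀ * C.toCols₁) (C.toCols₂ᵀ * C.toCols₂) := by
  ext (i | i) (j | j) <;> simp [Matrix.mul_apply, toCols₁, toCols₂]

variable {d a κ μ : Type*} [Fintype d] [Fintype a] [Fintype κ] [Fintype μ]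

theorem blocks_of_symm [DecidableEq d] {P : Matrix (d ⊕ a) (d ⊕ a) ℝ}
    (h : (fromBlocks 1 0 0 0 : Matrix (d ⊕ a) (d ⊕ a) ℝ)ᵀ * P = Pᵀ * fromBlocks 1 0 0 0) :
    P.toBlocks₁₁ᵀ = P.toBlocks₁₁ ∧ P.toBlocks₁₂ = 0 := by
  rw [← fromBlocks_toBlocks P] at h
  simp only [fromBlocks_transpose, fromBlocks_multiply] at h
  obtain ⟨h1, h2, -, -⟩ := fromBlocks_inj.1 h
  simp only [transpose_one, transpose_zero, Matrix.one_mul, Matrix.zero_mul, Matrix.mul_zero,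
    Matrix.mul_one, add_zero] at h1 h2
  exact ⟨h1.symm, h2⟩

theorem closedLoop_blocks (A P : Matrix (d ⊕ a) (d ⊕ a) ℝ) (B : Matrix (d ⊕ a) μ ℝ)
    (h12 : P.toBlocks₁₂ = 0) :
    (closedLoop A B P).toBlocks₁₁ = A.toBlocks₁₁ - B.toRows₁ *
      (B.toRows₁ᵀ * P.toBlocks₁₁ + B.toRows₂ᵀ * P.toBlocks₂₁) ∧
    (closedLoop A B P).toBlocks₁₂ = A.toBlocks₁₂ - B.toRows₁ * B.toRows₂ᵀ * P.toBlocks₂₂ ∧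
    (closedLoop A B P).toBlocks₂₁ = A.toBlocks₂₁ - B.toRows₂ *
      (B.toRows₁ᵀ * P.toBlocks₁₁ + B.toRows₂ᵀ * P.toBlocks₂₁) ∧
    (closedLoop A B P).toBlocks₂₂ = A.toBlocks₂₂ - B.toRows₂ * B.toRows₂ᵀ * P.toBlocks₂₂ := by
  have h : closedLoop A B P = fromBlocks
      (A.toBlocks₁₁ - B.toRows₁ * (B.toRows₁ᵀ * P.toBlocks₁₁ + B.toRows₂ᵀ * P.toBlocks₂₁))
      (A.toBlocks₁₂ - B.toRows₁ * B.toRows₂ᵀ * P.toBlocks₂₂)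
      (A.toBlocks₂₁ - B.toRows₂ * (B.toRows₁ᵀ * P.toBlocks₁₁ + B.toRows₂ᵀ * P.toBlocks₂₁))
      (A.toBlocks₂₂ - B.toRows₂ * B.toRows₂ᵀ * P.toBlocks₂₂) := by
    rw [closedLoop, fromBlocks_toRows_mul_transpose]
    conv_lhs => rw [← fromBlocks_toBlocks A, ← fromBlocks_toBlocks P, h12]
    rw [fromBlocks_multiply, sub_eq_add_neg, fromBlocks_neg, fromBlocks_add]
    simp only [← sub_eq_add_neg, Matrix.mul_add, Matrix.mul_zero, zero_add, Matrix.mul_assoc]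
  rw [h]
  exact ⟨toBlocks_fromBlocks₁₁ .., toBlocks_fromBlocks₁₂ .., toBlocks_fromBlocks₂₁ ..,
    toBlocks_fromBlocks₂₂ ..⟩

/-- The Riccati equation of the ordinary differential equation obtained by eliminating the
algebraic variables. -/
theorem reduced_riccati [DecidableEq d] [DecidableEq a]
    {A P : Matrix (d ⊕ a) (d ⊕ a) ℝ} {B : Matrix (d ⊕ a) μ ℝ}
    {C : Matrix κ (d ⊕ a) ℝ}
    (hric : Aᵀ * P + Pᵀ * A - Pᵀ * B * Bᵀ * P + Cᵀ * C = 0)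
    (hsymm : P.toBlocks₁₁ᵀ = P.toBlocks₁₁) (h12 : P.toBlocks₁₂ = 0)
    (hunit : IsUnit (closedLoop A B P).toBlocks₂₂) :
    (Abar (closedLoop A B P))ᵀ * P.toBlocks₁₁ + P.toBlocks₁₁ * Abar (closedLoop A B P) +
      P.toBlocks₁₁ * Bbar (closedLoop A B P) B * (Bbar (closedLoop A B P) B)ᵀ * P.toBlocks₁₁ +
      Qtilde A B C P = 0 := by
  obtain ⟨hM11, hM12, hM21, hM22⟩ := closedLoop_blocks A P B h12
  set M := closedLoop A B P
  have hK : K2 A B P = M.toBlocks₂₂ᵀ := by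
    rw [hM22, K2]
    simp only [transpose_sub, transpose_mul, transpose_transpose, Matrix.mul_assoc]
  have hKinv : (K2 A B P)⁻¹ = (M.toBlocks₂₂⁻¹)ᵀ := by rw [hK, transpose_nonsing_inv]
  have hKK : (K2 A B P)⁻¹ * K2 A B P = 1 :=
    nonsing_inv_mul _ (by
      rw [hK, det_transpose]; exact (isUnit_iff_isUnit_det _).1 hunit)
  rw [Matrix.mul_assoc Pᵀ B, fromBlocks_toRows_mul_transpose,
    transpose_mul_eq_fromBlocks_toCols] at hric
  rw [← fromBlocks_toBlocks A, ← fromBlocks_toBlocks P, h12] at hric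
  rw [sub_eq_add_neg] at hric
  simp only [fromBlocks_transpose, fromBlocks_multiply, fromBlocks_add, fromBlocks_neg,
    transpose_zero, Matrix.mul_zero, Matrix.zero_mul, zero_add] at hric
  rw [← fromBlocks_zero] at hric
  obtain ⟨r11, -, r21, -⟩ := fromBlocks_inj.1 hric
  simp only [Qtilde]
  have hA : Abar M = M.toBlocks₁₁ - M.toBlocks₁₂ * M.toBlocks₂₂⁻¹ * M.toBlocks₂₁ := rfl
  have hB : Bbar M B = B.toRows₁ - M.toBlocks₁₂ * M.toBlocks₂₂⁻¹ * B.toRows₂ := rfl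
  set L := (K2 A B P)⁻¹
  have hLt : M.toBlocks₂₂⁻¹ = Lᵀ := by rw [hKinv, transpose_transpose]
  rw [hA, hB, hLt, hM11, hM21]
  set Z := M.toBlocks₁₂ * Lᵀ with hZ
  set N := C.toCols₂ᵀ * C.toCols₁ + P.toBlocks₂₂ᵀ * A.toBlocks₂₁ with hN
  -- The lower left block of the Riccati equation, solved with `K₂⁻¹`, expresses the mixed terms of
  -- `Q̃` through blocks of `P`.
  have hY : L * N = -(P.toBlocks₂₁ + Zᵀ * P.toBlocks₁₁) := by
    have h1 : N = -(M.toBlocks₁₂ᵀ * P.toBlocks₁₁ + K2 A B P * P.toBlocks₂₁) := by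
      rw [eq_neg_iff_add_eq_zero, ← r21, hN, hM12, K2]
      simp only [transpose_sub, transpose_mul, transpose_transpose, Matrix.sub_mul,
        Matrix.mul_assoc]
      abel
    rw [h1, Matrix.mul_neg, Matrix.mul_add, ← Matrix.mul_assoc L (K2 A B P), hKK, Matrix.one_mul,
      hZ, transpose_mul, transpose_transpose, ← Matrix.mul_assoc, add_comm]
  have hY' : (C.toCols₁ᵀ * C.toCols₂ + A.toBlocks₂₁ᵀ * P.toBlocks₂₂) * Lᵀ =
      -(P.toBlocks₂₁ᵀ + P.toBlocks₁₁ * Z) := by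
    have := congrArg transpose hY
    rw [hN] at this
    simpa only [transpose_neg, transpose_add, transpose_mul, transpose_transpose, hsymm] using this
  -- The upper left block eliminates `C₁* C₁`; afterwards the identity is a matter of expansion.
  have hC : C.toCols₁ᵀ * C.toCols₁ = -(A.toBlocks₁₁ᵀ * P.toBlocks₁₁ + A.toBlocks₂₁ᵀ * P.toBlocks₂₁ +
      (P.toBlocks₁₁ᵀ * A.toBlocks₁₁ + P.toBlocks₂₁ᵀ * A.toBlocks₂₁) +
      -((P.toBlocks₁₁ᵀ * (B.toRows₁ * B.toRows₁ᵀ) + P.toBlocks₂₁ᵀ * (B.toRows₂ * B.toRows₁ᵀ)) *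
        P.toBlocks₁₁ + (P.toBlocks₁₁ᵀ * (B.toRows₁ * B.toRows₂ᵀ) +
          P.toBlocks₂₁ᵀ * (B.toRows₂ * B.toRows₂ᵀ)) * P.toBlocks₂₁)) :=
    (neg_eq_of_add_eq_zero_right r11).symm
  rw [add_comm (A.toBlocks₂₁ᵀ * P.toBlocks₂₂), hY',
    Matrix.mul_assoc (_ * B.toRows₂ᵀ) L N, Matrix.mul_assoc A.toBlocks₂₁ᵀ L N, hY, hC]
  simp only [transpose_sub, transpose_add, transpose_mul, transpose_transpose, hsymm,
    Matrix.mul_add, Matrix.add_mul, Matrix.mul_sub, Matrix.sub_mul, Matrix.mul_neg, Matrix.neg_mul,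
    Matrix.mul_assoc]
  abel

end Reduction

/-! ### Integration by parts and square integrability. -/

section Verification

variable {κ μ : Type*}

/-- Competitors only make `E x` absolutely continuous, so integration by parts is needed with one
merely absolutely continuous factor. The boundary term at `0` vanishes with the integral. -/
theorem integral_deriv_mul_add_mul_of_integral {f f' g q : ℝ → ℝ} {t₁ : ℝ} (ht₁ : 0 ≤ t₁)
    (hf : ∀ t, HasDerivAt f (f' t) t) (hf' : Continuous f')
    (hq : IntervalIntegrable q volume 0 t₁) (hg : ∀ t ∈ Icc 0 t₁, g t = ∫ s in (0 : ℝ)..t, q s) :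
    ∫ s in (0 : ℝ)..t₁, (f' s * g s + f s * q s) = f t₁ * g t₁ := by
  set Q : ℝ → ℝ := fun t => ∫ s in (0 : ℝ)..t, q s with hQ
  have hfd : deriv f = f' := funext fun t => (hf t).deriv
  have hfac : AbsolutelyContinuousOnInterval f 0 t₁ := by
    refine ContDiffOn.absolutelyContinuousOnInterval (ContDiff.contDiffOn ?_)
    exact contDiff_one_iff_deriv.2 ⟨fun t => (hf t).differentiableAt, by rwa [hfd]⟩
  have hQac : AbsolutelyContinuousOnInterval Q 0 t₁ :=
    hq.absolutelyContinuousOnInterval_intervalIntegral left_mem_uIcc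
  have h := hfac.integral_deriv_mul_eq_sub hQac
  have hQ0 : Q 0 = 0 := by simp [hQ]
  rw [hQ0, mul_zero, sub_zero, show Q t₁ = g t₁ from (hg t₁ ⟨ht₁, le_rfl⟩).symm] at h
  rw [← h]
  refine intervalIntegral.integral_congr_ae ?_
  filter_upwards [hq.ae_hasDerivAt_integral] with s hs hmem
  have hs' : s ∈ uIcc 0 t₁ := uIoc_subset_uIcc hmem
  rw [hfd, (hs hs' 0 left_mem_uIcc).deriv, hg s (by rwa [uIcc_of_le ht₁] at hs')]

/-- Every coordinate is square integrable on `[0, t₁]`. -/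
def CoordL2 (t₁ : ℝ) (v : ℝ → κ → ℝ) : Prop :=
  ∀ i, MemLp (fun s => v s i) 2 (volume.restrict (Icc 0 t₁))

theorem CoordL2.sub {t₁ : ℝ} {v w : ℝ → κ → ℝ} (hv : CoordL2 t₁ v) (hw : CoordL2 t₁ w) :
    CoordL2 t₁ fun s => v s - w s := fun i => (hv i).sub (hw i)

theorem CoordL2.add {t₁ : ℝ} {v w : ℝ → κ → ℝ} (hv : CoordL2 t₁ v) (hw : CoordL2 t₁ w) :
    CoordL2 t₁ fun s => v s + w s := fun i => (hv i).add (hw i)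

theorem CoordL2.mulVec [Fintype μ] {t₁ : ℝ} {v : ℝ → μ → ℝ} (hv : CoordL2 t₁ v) (M : Matrix κ μ ℝ) :
    CoordL2 t₁ fun s => M *ᵥ v s := fun i => by
  simp only [Matrix.mulVec, dotProduct]
  exact memLp_finsetSum _ fun j _ => (hv j).const_mul _

theorem coordL2_of_continuous (t₁ : ℝ) {v : ℝ → κ → ℝ} (hv : Continuous v) : CoordL2 t₁ v := by
  intro i
  have hc : Continuous fun s => v s i := (continuous_apply i).comp hv
  obtain ⟨C, hC⟩ := (isCompact_Icc (a := (0 : ℝ)) (b := t₁)).exists_bound_of_continuousOn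
    hc.continuousOn
  refine MemLp.of_bound hc.aestronglyMeasurable C ?_
  exact (ae_restrict_mem measurableSet_Icc).mono fun s hs => hC s hs

end Verification

/-! ### Sufficient optimality conditions. -/

section Optimality

variable {ι κ ℓ μ : Type*} [Fintype ι] [DecidableEq ι] [Fintype κ] [Fintype ℓ]
  [Fintype μ] [DecidableEq μ]

theorem CoordL2.integrable_dotProduct {t₁ : ℝ} {v w : ℝ → κ → ℝ} (hv : CoordL2 t₁ v)
    (hw : CoordL2 t₁ w) : IntegrableOn (fun s => v s ⬝ᵥ w s) (Icc 0 t₁) := by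
  simp only [dotProduct]
  exact integrable_finsetSum _ fun i _ => (hv i).integrable_mul (hw i)

theorem CoordL2.intervalIntegrable_dotProduct {t₁ : ℝ} (ht₁ : 0 ≤ t₁) {v w : ℝ → κ → ℝ}
    (hv : CoordL2 t₁ v) (hw : CoordL2 t₁ w) :
    IntervalIntegrable (fun s => v s ⬝ᵥ w s) volume 0 t₁ :=
  (intervalIntegrable_iff_integrableOn_Icc_of_le ht₁).2 (hv.integrable_dotProduct hw)

theorem coordL2_of_memLp {t₁ : ℝ} {x : ℝ → EuclideanSpace ℝ κ}
    (hx : MemLp x 2 (volume.restrict (Icc 0 t₁))) : CoordL2 t₁ fun s => (x s).ofLp := fun i =>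
  (EuclideanSpace.proj (𝕜 := ℝ) i).comp_memLp' hx

theorem memLp_of_continuous (t₁ : ℝ) {x : ℝ → EuclideanSpace ℝ κ} (hx : Continuous x) :
    MemLp x 2 (volume.restrict (Icc 0 t₁)) := by
  obtain ⟨C, hC⟩ := (isCompact_Icc (a := (0 : ℝ)) (b := t₁)).exists_bound_of_continuousOn
    hx.continuousOn
  refine MemLp.of_bound hx.aestronglyMeasurable C ?_
  exact (ae_restrict_mem measurableSet_Icc).mono fun s hs => hC s hs

theorem norm_sq_eq_dotProduct (y : EuclideanSpace ℝ κ) : ‖y‖ ^ 2 = y.ofLp ⬝ᵥ y.ofLp := by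
  rw [EuclideanSpace.real_norm_sq_eq]
  simp [dotProduct, sq]

theorem IsAdmissible.coord_dae {E A : Matrix ι ι ℝ} {B : Matrix ι μ ℝ} {x₀ : EuclideanSpace ℝ ι}
    {t₁ : ℝ} {x : ℝ → EuclideanSpace ℝ ι} {u : ℝ → EuclideanSpace ℝ μ}
    (h : IsAdmissible E A B x₀ t₁ x u) (i : ι) (t : ℝ) (ht : t ∈ Icc 0 t₁) :
    (E *ᵥ (x t).ofLp) i = (E *ᵥ x₀.ofLp) i +
      ∫ s in (0 : ℝ)..t, (A *ᵥ (x s).ofLp + B *ᵥ (u s).ofLp) i := by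
  have hA : MemLp (fun s => (toEuclideanLin A).toContinuousLinearMap (x s)) 2
      (volume.restrict (Icc 0 t₁)) := ContinuousLinearMap.comp_memLp' _ h.memLp_x
  have hB : MemLp (fun s => (toEuclideanLin B).toContinuousLinearMap (u s)) 2
      (volume.restrict (Icc 0 t₁)) := ContinuousLinearMap.comp_memLp' _ h.memLp_u
  have hint : IntervalIntegrable (fun s => toEuclideanLin A (x s) + toEuclideanLin B (u s))
      volume 0 t := by
    rw [intervalIntegrable_iff_integrableOn_Icc_of_le ht.1]
    have : IntegrableOn (fun s => toEuclideanLin A (x s) + toEuclideanLin B (u s)) (Icc 0 t₁) :=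
      (hA.add hB).integrable (by norm_num)
    exact this.mono_set (Icc_subset_Icc_right ht.2)
  have h1 := congrArg (EuclideanSpace.proj (𝕜 := ℝ) i) (h.dae t ht)
  rw [map_add, ← ContinuousLinearMap.intervalIntegral_comp_comm _ hint] at h1
  exact h1

theorem dotProduct_self_add_two_mul_le (v w : κ → ℝ) :
    v ⬝ᵥ v + 2 * (v ⬝ᵥ (w - v)) ≤ w ⬝ᵥ w := by
  have h0 : 0 ≤ (w - v) ⬝ᵥ (w - v) := by simpa using dotProduct_star_self_nonneg (w - v)
  simp only [sub_dotProduct, dotProduct_sub] at h0 ⊢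
  rw [dotProduct_comm w v] at h0
  linarith

/-- Sufficiency of the first order optimality conditions. -/
theorem cost_le_of_costate {E A : Matrix ι ι ℝ} {B : Matrix ι μ ℝ} {C : Matrix κ ι ℝ}
    {F : Matrix ℓ ι ℝ} {x₀ : EuclideanSpace ℝ ι} {t₁ : ℝ} (ht₁ : 0 ≤ t₁)
    {x : ℝ → EuclideanSpace ℝ ι} {u : ℝ → EuclideanSpace ℝ μ}
    (hxu : IsAdmissible E A B x₀ t₁ x u) {p p' : ℝ → ι → ℝ}
    (hp : ∀ t, HasDerivAt p (p' t) t) (hp' : Continuous p')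
    (hadj : ∀ t, Eᵀ *ᵥ p' t = -(Aᵀ *ᵥ p t + Cᵀ *ᵥ (C *ᵥ (x t).ofLp)))
    (hu : ∀ t, (u t).ofLp = -(Bᵀ *ᵥ p t))
    (hend : Eᵀ *ᵥ p t₁ = Fᵀ *ᵥ (F *ᵥ (x t₁).ofLp))
    {x' : ℝ → EuclideanSpace ℝ ι} {u' : ℝ → EuclideanSpace ℝ μ}
    (hxu' : IsAdmissible E A B x₀ t₁ x' u') :
    cost C F 0 0 t₁ x u ≤ cost C F 0 0 t₁ x' u' := by
  set X : ℝ → ι → ℝ := fun s => (x s).ofLp with hX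
  set U : ℝ → μ → ℝ := fun s => (u s).ofLp with hU
  set ξ : ℝ → ι → ℝ := fun s => (x' s).ofLp - (x s).ofLp with hξ
  set η : ℝ → μ → ℝ := fun s => (u' s).ofLp - (u s).ofLp with hη
  have hXL : CoordL2 t₁ X := coordL2_of_memLp hxu.memLp_x
  have hUL : CoordL2 t₁ U := coordL2_of_memLp hxu.memLp_u
  have hξL : CoordL2 t₁ ξ := (coordL2_of_memLp hxu'.memLp_x).sub hXL
  have hηL : CoordL2 t₁ η := (coordL2_of_memLp hxu'.memLp_u).sub hUL
  set q : ℝ → ι → ℝ := fun s => A *ᵥ ξ s + B *ᵥ η s with hq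
  have hqL : CoordL2 t₁ q := (hξL.mulVec A).add (hηL.mulVec B)
  have hpc : Continuous p := continuous_iff_continuousAt.2 fun t => (hp t).continuousAt
  have hpL : CoordL2 t₁ p := coordL2_of_continuous t₁ hpc
  have hpL' : CoordL2 t₁ p' := coordL2_of_continuous t₁ hp'
  have hqint : ∀ i, IntegrableOn (fun s => q s i) (Icc 0 t₁) := fun i =>
    (hqL i).integrable (by norm_num)
  -- The two pairs share their initial value, so `E ξ` starts at zero.
  have hdae : ∀ i, ∀ t ∈ Icc 0 t₁, (E *ᵥ ξ t) i = ∫ s in (0 : ℝ)..t, q s i := by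
    intro i t ht
    have hL : ∀ {y : ℝ → EuclideanSpace ℝ ι} {w : ℝ → EuclideanSpace ℝ μ},
        IsAdmissible E A B x₀ t₁ y w → IntervalIntegrable
          (fun s => (A *ᵥ (y s).ofLp + B *ᵥ (w s).ofLp) i) volume 0 t := fun hyw => by
      rw [intervalIntegrable_iff_integrableOn_Icc_of_le ht.1]
      have h2 : IntegrableOn _ (Icc 0 t₁) :=
        ((((coordL2_of_memLp hyw.memLp_x).mulVec A).add
          ((coordL2_of_memLp hyw.memLp_u).mulVec B)) i).integrable (by norm_num)
      exact h2.mono_set (Icc_subset_Icc_right ht.2)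
    have h1 := hxu.coord_dae i t ht
    have h2 := hxu'.coord_dae i t ht
    rw [hξ, mulVec_sub, Pi.sub_apply, h1, h2, add_sub_add_left_eq_sub,
      ← intervalIntegral.integral_sub (hL hxu') (hL hxu)]
    refine intervalIntegral.integral_congr fun s _ => ?_
    simp only [hq, hξ, hη, mulVec_sub, Pi.add_apply, Pi.sub_apply]
    ring
  set g : ℝ → ℝ := fun s => (C *ᵥ X s) ⬝ᵥ (C *ᵥ ξ s) + U s ⬝ᵥ η s with hg
  have hgint : IntervalIntegrable g volume 0 t₁ :=
    ((hXL.mulVec C).intervalIntegrable_dotProduct ht₁ (hξL.mulVec C)).add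
      (hUL.intervalIntegrable_dotProduct ht₁ hηL)
  -- Adjoint equation and control law make the first variation of the running cost minus the formal
  -- derivative of `p · E ξ`.
  have hgeq : ∀ s, g s = -∑ i, (p' s i * (E *ᵥ ξ s) i + p s i * q s i) := by
    intro s
    have e1 : (C *ᵥ X s) ⬝ᵥ (C *ᵥ ξ s) = (Cᵀ *ᵥ (C *ᵥ X s)) ⬝ᵥ ξ s := by
      rw [dotProduct_mulVec, mulVec_transpose]
    have e2 : Cᵀ *ᵥ (C *ᵥ X s) = -(Eᵀ *ᵥ p' s) - Aᵀ *ᵥ p s := by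
      rw [hadj s]; abel
    have e3 : U s = -(Bᵀ *ᵥ p s) := hu s
    have e4 : ∑ i, (p' s i * (E *ᵥ ξ s) i + p s i * q s i) =
        p' s ⬝ᵥ (E *ᵥ ξ s) + p s ⬝ᵥ q s := by
      simp [dotProduct, Finset.sum_add_distrib]
    rw [e4, hg]
    simp only [hq]
    rw [e1, e2, e3, dotProduct_add, dotProduct_mulVec, dotProduct_mulVec, dotProduct_mulVec,
      sub_dotProduct, neg_dotProduct, neg_dotProduct, mulVec_transpose, mulVec_transpose,
      mulVec_transpose]
    ring
  have hgI : ∫ s in (0 : ℝ)..t₁, g s = -((F *ᵥ X t₁) ⬝ᵥ (F *ᵥ ξ t₁)) := by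
    have e1 : ∀ i, IntervalIntegrable
        (fun s => p' s i * (E *ᵥ ξ s) i + p s i * q s i) volume 0 t₁ := fun i => by
      rw [intervalIntegrable_iff_integrableOn_Icc_of_le ht₁]
      exact ((hpL' i).integrable_mul ((hξL.mulVec E) i)).add ((hpL i).integrable_mul (hqL i))
    rw [intervalIntegral.integral_congr fun s _ => hgeq s, intervalIntegral.integral_neg,
      intervalIntegral.integral_finsetSum fun i _ => e1 i]
    rw [Finset.sum_congr rfl fun i _ => integral_deriv_mul_add_mul_of_integral ht₁
      (fun t => hasDerivAt_pi.1 (hp t) i) ((continuous_apply i).comp hp')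
      ((intervalIntegrable_iff_integrableOn_Icc_of_le ht₁).2 (hqint i)) (hdae i)]
    have e2 : ∑ i, p t₁ i * (E *ᵥ ξ t₁) i = p t₁ ⬝ᵥ (E *ᵥ ξ t₁) := rfl
    rw [e2, dotProduct_mulVec, ← mulVec_transpose, hend, dotProduct_mulVec (F *ᵥ X t₁),
      ← mulVec_transpose]
  have hcost : ∀ (y : ℝ → EuclideanSpace ℝ ι) (w : ℝ → EuclideanSpace ℝ μ),
      cost C F 0 0 t₁ y w = 1 / 2 * (∫ s in (0 : ℝ)..t₁, ((C *ᵥ (y s).ofLp) ⬝ᵥ (C *ᵥ (y s).ofLp) +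
        (w s).ofLp ⬝ᵥ (w s).ofLp)) + 1 / 2 * ((F *ᵥ (y t₁).ofLp) ⬝ᵥ (F *ᵥ (y t₁).ofLp)) := by
    intro y w
    simp only [cost, sub_zero, norm_sq_eq_dotProduct]
    rfl
  have hcint : ∀ {y : ℝ → EuclideanSpace ℝ ι} {w : ℝ → EuclideanSpace ℝ μ},
      IsAdmissible E A B x₀ t₁ y w → IntervalIntegrable (fun s =>
        (C *ᵥ (y s).ofLp) ⬝ᵥ (C *ᵥ (y s).ofLp) + (w s).ofLp ⬝ᵥ (w s).ofLp) volume 0 t₁ :=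
    fun hyw =>
      (((coordL2_of_memLp hyw.memLp_x).mulVec C).intervalIntegrable_dotProduct ht₁
        ((coordL2_of_memLp hyw.memLp_x).mulVec C)).add
      ((coordL2_of_memLp hyw.memLp_u).intervalIntegrable_dotProduct ht₁
        (coordL2_of_memLp hyw.memLp_u))
  rw [hcost, hcost]
  -- Tangent inequality for the squared norms, integrated. The linear term cancels against that of
  -- the end cost by `hgI`.
  have hmono : (∫ s in (0 : ℝ)..t₁, ((C *ᵥ (x s).ofLp) ⬝ᵥ (C *ᵥ (x s).ofLp) +
        (u s).ofLp ⬝ᵥ (u s).ofLp)) + 2 * ∫ s in (0 : ℝ)..t₁, g s ≤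
      ∫ s in (0 : ℝ)..t₁, ((C *ᵥ (x' s).ofLp) ⬝ᵥ (C *ᵥ (x' s).ofLp) +
        (u' s).ofLp ⬝ᵥ (u' s).ofLp) := by
    rw [← intervalIntegral.integral_const_mul, ← intervalIntegral.integral_add (hcint hxu)
      (hgint.const_mul 2)]
    refine intervalIntegral.integral_mono_on ht₁ ((hcint hxu).add (hgint.const_mul 2))
      (hcint hxu') fun s _ => ?_
    have h1 := dotProduct_self_add_two_mul_le (C *ᵥ (x s).ofLp) (C *ᵥ (x' s).ofLp)
    have h2 := dotProduct_self_add_two_mul_le (u s).ofLp (u' s).ofLp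
    rw [← mulVec_sub] at h1
    simp only [hg, hX, hU, hξ, hη]
    linarith
  have hF := dotProduct_self_add_two_mul_le (F *ᵥ (x t₁).ofLp) (F *ᵥ (x' t₁).ofLp)
  rw [← mulVec_sub] at hF
  rw [hgI] at hmono
  simp only [hX, hξ] at hmono
  linarith

/-- Smooth solutions of the state equation are classical and admissible. -/
theorem isClassicalSolution_and_isAdmissible {E A : Matrix ι ι ℝ} {B : Matrix ι μ ℝ}
    {x₀ : EuclideanSpace ℝ ι} {t₁ : ℝ} (ht₁ : 0 < t₁) {x x' : ℝ → ι → ℝ} {u : ℝ → μ → ℝ}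
    (hx : ∀ t, HasDerivAt x (x' t) t) (hu : Continuous u)
    (hdae : ∀ t, E *ᵥ x' t = A *ᵥ x t + B *ᵥ u t) (h0 : E *ᵥ x 0 = E *ᵥ x₀.ofLp) :
    IsClassicalSolution E A B x₀ t₁ (fun t => WithLp.toLp 2 (x t)) (fun t => WithLp.toLp 2 (u t)) ∧
    IsAdmissible E A B x₀ t₁ (fun t => WithLp.toLp 2 (x t)) (fun t => WithLp.toLp 2 (u t)) := by
  have hd : ∀ t, HasDerivAt (fun t => WithLp.toLp 2 (x t) : ℝ → EuclideanSpace ℝ ι)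
      (WithLp.toLp 2 (x' t)) t := fun t =>
    ((EuclideanSpace.equiv ι ℝ).symm : (ι → ℝ) →L[ℝ] EuclideanSpace ℝ ι).hasFDerivAt.comp_hasDerivAt
      t (hx t)
  have hxc : Continuous (fun t => WithLp.toLp 2 (x t) : ℝ → EuclideanSpace ℝ ι) :=
    continuous_iff_continuousAt.2 fun t => (hd t).continuousAt
  have huc : Continuous (fun t => WithLp.toLp 2 (u t) : ℝ → EuclideanSpace ℝ μ) :=
    (EuclideanSpace.equiv μ ℝ).symm.continuous.comp hu
  refine ⟨⟨fun t _ => (hd t).differentiableAt.differentiableWithinAt, huc.continuousOn,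
    fun t ht => ?_, ?_⟩, ⟨memLp_of_continuous t₁ hxc, memLp_of_continuous t₁ huc, fun t ht => ?_⟩⟩
  · rw [(hd t).hasDerivWithinAt.derivWithin (uniqueDiffOn_Icc ht₁ t ht)]
    exact congrArg (WithLp.toLp 2) (hdae t)
  · exact congrArg (WithLp.toLp 2) h0
  · have hE : ∀ s, HasDerivAt (fun t => toEuclideanLin E (WithLp.toLp 2 (x t)))
        (toEuclideanLin A (WithLp.toLp 2 (x s)) + toEuclideanLin B (WithLp.toLp 2 (u s))) s :=
      fun s => by
        have h1 := (toEuclideanLin E).toContinuousLinearMap.hasFDerivAt.comp_hasDerivAt s (hd s)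
        refine h1.congr_deriv ?_
        exact congrArg (WithLp.toLp 2) (hdae s)
    have hc : Continuous fun s => toEuclideanLin A (WithLp.toLp 2 (x s)) +
        toEuclideanLin B (WithLp.toLp 2 (u s)) :=
      ((toEuclideanLin A).toContinuousLinearMap.continuous.comp hxc).add
        ((toEuclideanLin B).toContinuousLinearMap.continuous.comp huc)
    rw [intervalIntegral.integral_eq_sub_of_hasDerivAt (fun s _ => hE s)
      (hc.intervalIntegrable 0 t)]
    have : toEuclideanLin E (WithLp.toLp 2 (x 0)) = toEuclideanLin E x₀ :=
      congrArg (WithLp.toLp 2) h0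
    rw [this, add_sub_cancel]

end Optimality

/-! ### Lifting the reduced trajectories to the differential-algebraic system. -/

section FullTrajectories

theorem mulVec_sumElim {d a : Type*} [Fintype d] [Fintype a] (N : Matrix (d ⊕ a) (d ⊕ a) ℝ) (v : d → ℝ) (w : a → ℝ) :
    N *ᵥ Sum.elim v w = Sum.elim (N.toBlocks₁₁ *ᵥ v + N.toBlocks₁₂ *ᵥ w)
      (N.toBlocks₂₁ *ᵥ v + N.toBlocks₂₂ *ᵥ w) := by
  conv_lhs => rw [← fromBlocks_toBlocks N]
  rw [fromBlocks_mulVec]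
  simp only [Sum.elim_comp_inl, Sum.elim_comp_inr]

theorem mulVec_eq_sumElim_toRows {d a μ : Type*} [Fintype μ] (B : Matrix (d ⊕ a) μ ℝ) (v : μ → ℝ) :
    B *ᵥ v = Sum.elim (B.toRows₁ *ᵥ v) (B.toRows₂ *ᵥ v) := by
  ext (i | i) <;> rfl

theorem transpose_mulVec_sumElim {d a μ : Type*} [Fintype d] [Fintype a]
    (B : Matrix (d ⊕ a) μ ℝ) (v : d → ℝ) (w : a → ℝ) :
    Bᵀ *ᵥ Sum.elim v w = B.toRows₁ᵀ *ᵥ v + B.toRows₂ᵀ *ᵥ w := by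
  ext i
  simp [mulVec, dotProduct, toRows₁, toRows₂]

theorem sumElim_add_sumElim {d a : Type*} (v v' : d → ℝ) (w w' : a → ℝ) :
    Sum.elim v w + Sum.elim v' w' = Sum.elim (v + v') (w + w') := by
  ext (i | i) <;> rfl

theorem differential_mulVec_sumElim {d a : Type*} [Fintype d] [DecidableEq d] [Fintype a]
    (v : d → ℝ) (w : a → ℝ) :
    (fromBlocks 1 0 0 0 : Matrix (d ⊕ a) (d ⊕ a) ℝ) *ᵥ Sum.elim v w = Sum.elim v 0 := by
  rw [fromBlocks_mulVec]
  simp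

variable {d a μ : Type*} [Fintype d] [Fintype a] [DecidableEq a] [Fintype μ]

/-- The state of the closed loop system with differential part `x` and input `-B̄* l`. -/
noncomputable def fullState (M : Matrix (d ⊕ a) (d ⊕ a) ℝ) (B : Matrix (d ⊕ a) μ ℝ) (x l : d → ℝ) :
    d ⊕ a → ℝ :=
  Sum.elim x (-(M.toBlocks₂₂⁻¹ *ᵥ (M.toBlocks₂₁ *ᵥ x - B.toRows₂ *ᵥ ((Bbar M B)ᵀ *ᵥ l))))

/-- The control `-B̄* l - B* P x` belonging to `fullState`. -/
noncomputable def fullControl (M P : Matrix (d ⊕ a) (d ⊕ a) ℝ) (B : Matrix (d ⊕ a) μ ℝ)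
    (x l : d → ℝ) : μ → ℝ :=
  -((Bbar M B)ᵀ *ᵥ l) - Bᵀ *ᵥ (P *ᵥ fullState M B x l)

/-- The extension of a costate of the reduced system to the algebraic variables. -/
noncomputable def extendCostate (M : Matrix (d ⊕ a) (d ⊕ a) ℝ) (l : d → ℝ) : d ⊕ a → ℝ :=
  Sum.elim l (-((M.toBlocks₁₂ * M.toBlocks₂₂⁻¹)ᵀ *ᵥ l))

theorem HasDerivAt.sumElim {α β : Type*} [Fintype α] [Fintype β] {v : ℝ → α → ℝ} {w : ℝ → β → ℝ}
    {v' : α → ℝ} {w' : β → ℝ} {t : ℝ} (hv : HasDerivAt v v' t) (hw : HasDerivAt w w' t) :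
    HasDerivAt (fun s => Sum.elim (v s) (w s)) (Sum.elim v' w') t := by
  refine hasDerivAt_pi.2 ?_
  rintro (i | i)
  exacts [hasDerivAt_pi.1 hv i, hasDerivAt_pi.1 hw i]

theorem continuous_sumElim {α β : Type*} {v : ℝ → α → ℝ} {w : ℝ → β → ℝ}
    (hv : Continuous v) (hw : Continuous w) : Continuous fun s => Sum.elim (v s) (w s) := by
  refine continuous_pi ?_
  rintro (i | i)
  exacts [(continuous_apply i).comp hv, (continuous_apply i).comp hw]

theorem continuous_const_mulVec {α β : Type*} [Fintype β] (N : Matrix α β ℝ) {v : ℝ → β → ℝ}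
    (hv : Continuous v) : Continuous fun s => N *ᵥ v s :=
  Continuous.matrix_mulVec continuous_const hv

variable {M : Matrix (d ⊕ a) (d ⊕ a) ℝ} {B : Matrix (d ⊕ a) μ ℝ} {x l : ℝ → d → ℝ}

theorem hasDerivAt_fullState {x' l' : d → ℝ} {t : ℝ}
    (hx : HasDerivAt x x' t) (hl : HasDerivAt l l' t) :
    HasDerivAt (fun s => fullState M B (x s) (l s)) (fullState M B x' l') t :=
  HasDerivAt.sumElim hx (HasDerivAt.const_mulVec _ ((HasDerivAt.const_mulVec _ hx).fun_sub
    (HasDerivAt.const_mulVec _ (HasDerivAt.const_mulVec _ hl)))).fun_neg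

theorem hasDerivAt_extendCostate {l' : d → ℝ} {t : ℝ} (hl : HasDerivAt l l' t) :
    HasDerivAt (fun s => extendCostate M (l s)) (extendCostate M l') t :=
  HasDerivAt.sumElim hl (HasDerivAt.const_mulVec _ hl).fun_neg

theorem continuous_fullState (hx : Continuous x) (hl : Continuous l) :
    Continuous fun s => fullState M B (x s) (l s) :=
  continuous_sumElim hx (continuous_const_mulVec _ ((continuous_const_mulVec _ hx).sub
    (continuous_const_mulVec _ (continuous_const_mulVec _ hl)))).neg

theorem continuous_extendCostate (hl : Continuous l) :
    Continuous fun s => extendCostate M (l s) :=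
  continuous_sumElim hl (continuous_const_mulVec _ hl).neg

theorem continuous_fullControl {P : Matrix (d ⊕ a) (d ⊕ a) ℝ} (hx : Continuous x)
    (hl : Continuous l) : Continuous fun s => fullControl M P B (x s) (l s) :=
  (continuous_const_mulVec _ hl).neg.sub
    (continuous_const_mulVec _ (continuous_const_mulVec _ (continuous_fullState hx hl)))

/-- The algebraic part of `fullState` solves the second block row; inserting it into the first row
produces the Schur complement `Ā` and the matrix `B̄`. -/
theorem closedLoop_mulVec_fullState (hM : IsUnit M.toBlocks₂₂) (x l : d → ℝ) :
    M *ᵥ fullState M B x l - B *ᵥ ((Bbar M B)ᵀ *ᵥ l) =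
      Sum.elim (Abar M *ᵥ x - Bbar M B *ᵥ ((Bbar M B)ᵀ *ᵥ l)) 0 := by
  have hinv : M.toBlocks₂₂ * M.toBlocks₂₂⁻¹ = 1 :=
    mul_nonsing_inv _ ((isUnit_iff_isUnit_det _).1 hM)
  set v := (Bbar M B)ᵀ *ᵥ l with hv
  have hBv : -(B *ᵥ v) = B *ᵥ (-v) := by rw [mulVec_neg]
  rw [fullState, ← hv, mulVec_sumElim, sub_eq_add_neg, hBv, mulVec_eq_sumElim_toRows,
    sumElim_add_sumElim]
  congr 1
  · rw [Abar, Bbar]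
    simp only [mulVec_neg, mulVec_sub, sub_mulVec, mulVec_mulVec, Matrix.mul_assoc]
    abel
  · simp only [mulVec_neg, mulVec_sub, mulVec_mulVec, ← Matrix.mul_assoc, hinv, Matrix.one_mul]
    abel

theorem transpose_mulVec_extendCostate (B : Matrix (d ⊕ a) μ ℝ) (l : d → ℝ) :
    Bᵀ *ᵥ extendCostate M l = (Bbar M B)ᵀ *ᵥ l := by
  rw [extendCostate, transpose_mulVec_sumElim, Bbar, transpose_sub, sub_mulVec,
    transpose_mul (M.toBlocks₁₂ * M.toBlocks₂₂⁻¹), mulVec_neg, mulVec_mulVec, sub_eq_add_neg]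

/-- The extension is chosen to annihilate the algebraic rows of the adjoint equation. -/
theorem closedLoop_transpose_mulVec_extendCostate (hM : IsUnit M.toBlocks₂₂) (l : d → ℝ) :
    Mᵀ *ᵥ extendCostate M l = Sum.elim ((Abar M)ᵀ *ᵥ l) 0 := by
  have hinv : M.toBlocks₂₂⁻¹ * M.toBlocks₂₂ = 1 :=
    nonsing_inv_mul _ ((isUnit_iff_isUnit_det _).1 hM)
  rw [extendCostate, mulVec_sumElim]
  congr 1
  · rw [Abar, transpose_sub, sub_mulVec, transpose_mul (M.toBlocks₁₂ * M.toBlocks₂₂⁻¹), mulVec_neg,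
      mulVec_mulVec, sub_eq_add_neg]
    rfl
  · have h : Mᵀ.toBlocks₂₂ * (M.toBlocks₁₂ * M.toBlocks₂₂⁻¹)ᵀ = M.toBlocks₁₂ᵀ := by
      rw [show Mᵀ.toBlocks₂₂ = M.toBlocks₂₂ᵀ from rfl, ← transpose_mul, Matrix.mul_assoc, hinv,
        Matrix.mul_one]
    rw [mulVec_neg, mulVec_mulVec, h]
    exact add_neg_cancel _

end FullTrajectories

/-! ### Optimality of the lifted pairs. -/

section Optimal

variable {d a κ ℓ μ : Type*} [Fintype d] [DecidableEq d] [Fintype a] [DecidableEq a]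
  [Fintype κ] [Fintype ℓ] [Fintype μ] [DecidableEq μ]

/-- The range condition says that the columns of `F` belonging to algebraic variables vanish. -/
theorem toBlocks_transpose_mul_self_of_range_le {F : Matrix ℓ (d ⊕ a) ℝ}
    (hF : LinearMap.range Fᵀ.mulVecLin ≤
      LinearMap.range (fromBlocks 1 0 0 0 : Matrix (d ⊕ a) (d ⊕ a) ℝ)ᵀ.mulVecLin)
    (v : d → ℝ) (w : a → ℝ) :
    Fᵀ *ᵥ (F *ᵥ Sum.elim v w) = Sum.elim ((Fᵀ * F).toBlocks₁₁ *ᵥ v) 0 := by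
  have hF0 : ∀ (y : ℓ → ℝ) (i : a), (Fᵀ *ᵥ y) (Sum.inr i) = 0 := fun y i => by
    obtain ⟨z, hz⟩ := hF ⟨y, rfl⟩
    rw [mulVecLin_apply, mulVecLin_apply] at hz
    rw [← hz, fromBlocks_transpose, fromBlocks_mulVec]
    simp
  have hF1 : ∀ j (i : a), F j (Sum.inr i) = 0 := fun j i => by
    classical
    have := hF0 (Pi.single j 1) i
    rwa [mulVec_single_one] at this
  ext (i | i)
  · rw [mulVec_mulVec, mulVec_sumElim]
    have : (Fᵀ * F).toBlocks₁₂ = 0 := by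
      ext i j; simp [toBlocks₁₂, Matrix.mul_apply, hF1]
    simp [this]
  · exact hF0 _ i

/-- Solutions of the reduced boundary value problem give optimal pairs. -/
theorem isOptimal_of_reduced {A P : Matrix (d ⊕ a) (d ⊕ a) ℝ} {B : Matrix (d ⊕ a) μ ℝ}
    {C : Matrix κ (d ⊕ a) ℝ} {F : Matrix ℓ (d ⊕ a) ℝ} {x₀ : EuclideanSpace ℝ (d ⊕ a)}
    (hF : LinearMap.range Fᵀ.mulVecLin ≤
      LinearMap.range (fromBlocks 1 0 0 0 : Matrix (d ⊕ a) (d ⊕ a) ℝ)ᵀ.mulVecLin)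
    (hric : Aᵀ * P + Pᵀ * A - Pᵀ * B * Bᵀ * P + Cᵀ * C = 0)
    (hsymm : (fromBlocks 1 0 0 0 : Matrix (d ⊕ a) (d ⊕ a) ℝ)ᵀ * P = Pᵀ * fromBlocks 1 0 0 0)
    {M : Matrix (d ⊕ a) (d ⊕ a) ℝ} (hMdef : M = closedLoop A B P) (hM : IsUnit M.toBlocks₂₂)
    {x l : ℝ → d → ℝ} {t₁ : ℝ} (ht₁ : 0 < t₁)
    (hx : ∀ t, HasDerivAt x (Abar M *ᵥ x t - Bbar M B *ᵥ ((Bbar M B)ᵀ *ᵥ l t)) t)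
    (hl : ∀ t, HasDerivAt l (-((Abar M)ᵀ *ᵥ l t)) t)
    (hx0 : x 0 = fun i => x₀ (Sum.inl i))
    (hend : l t₁ = ((Fᵀ * F).toBlocks₁₁ - P.toBlocks₁₁) *ᵥ x t₁) :
    IsOptimal (fromBlocks 1 0 0 0) A B C F 0 0 x₀ t₁
      (fun t => WithLp.toLp 2 (fullState M B (x t) (l t)))
      (fun t => WithLp.toLp 2 (fullControl M P B (x t) (l t))) := by
  obtain ⟨hP1, hP12⟩ := blocks_of_symm hsymm
  set E : Matrix (d ⊕ a) (d ⊕ a) ℝ := fromBlocks 1 0 0 0 with hE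
  have hEt : Eᵀ = E := by rw [hE, fromBlocks_transpose]; simp
  have hxc : Continuous x := continuous_iff_continuousAt.2 fun t => (hx t).continuousAt
  have hlc : Continuous l := continuous_iff_continuousAt.2 fun t => (hl t).continuousAt
  set X : ℝ → d ⊕ a → ℝ := fun t => fullState M B (x t) (l t)
  set U : ℝ → μ → ℝ := fun t => fullControl M P B (x t) (l t)
  set x' : ℝ → d → ℝ := fun t => Abar M *ᵥ x t - Bbar M B *ᵥ ((Bbar M B)ᵀ *ᵥ l t)
  set l' : ℝ → d → ℝ := fun t => -((Abar M)ᵀ *ᵥ l t)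
  have hx'c : Continuous x' := (continuous_const_mulVec _ hxc).sub
    (continuous_const_mulVec _ (continuous_const_mulVec _ hlc))
  have hl'c : Continuous l' := (continuous_const_mulVec _ hlc).neg
  have hX : ∀ t, HasDerivAt X (fullState M B (x' t) (l' t)) t := fun t =>
    hasDerivAt_fullState (hx t) (hl t)
  have hUc : Continuous U := continuous_fullControl hxc hlc
  have hEX : ∀ t, E *ᵥ fullState M B (x' t) (l' t) =
      M *ᵥ X t - B *ᵥ ((Bbar M B)ᵀ *ᵥ l t) := fun t => by
    rw [closedLoop_mulVec_fullState hM, fullState, hE, differential_mulVec_sumElim]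
  have hdae : ∀ t, E *ᵥ fullState M B (x' t) (l' t) = A *ᵥ X t + B *ᵥ U t := fun t => by
    have hMX : ∀ y, M *ᵥ y = A *ᵥ y - B *ᵥ (Bᵀ *ᵥ (P *ᵥ y)) := fun y => by
      rw [hMdef, closedLoop, sub_mulVec, mulVec_mulVec, mulVec_mulVec, Matrix.mul_assoc]
    have hUt : U t = -((Bbar M B)ᵀ *ᵥ l t) - Bᵀ *ᵥ (P *ᵥ X t) := rfl
    rw [hEX, hMX, hUt, mulVec_sub, mulVec_neg]
    abel
  have h0 : E *ᵥ X 0 = E *ᵥ x₀.ofLp := by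
    have : x₀.ofLp = Sum.elim (fun i => x₀ (Sum.inl i)) (fun i => x₀ (Sum.inr i)) := by
      ext (i | i) <;> rfl
    rw [this, hE, differential_mulVec_sumElim]
    simp only [X, fullState]
    rw [differential_mulVec_sumElim, hx0]
  obtain ⟨hcl, hadm⟩ := isClassicalSolution_and_isAdmissible ht₁ hX hUc hdae h0
  refine ⟨hcl, hadm, fun y w hyw => ?_⟩
  -- The costate is the Riccati part `P X` plus the extended correction `ν`.
  refine cost_le_of_costate ht₁.le hadm
    (p := fun t => P *ᵥ X t + extendCostate M (l t))
    (p' := fun t => P *ᵥ fullState M B (x' t) (l' t) + extendCostate M (l' t))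
    (fun t => (HasDerivAt.const_mulVec P (hX t)).fun_add (hasDerivAt_extendCostate (hl t)))
    ((continuous_const_mulVec P (continuous_fullState hx'c hl'c)).add
      (continuous_extendCostate hl'c)) (fun t => ?_) (fun t => ?_) ?_ hyw
  · have hC : Cᵀ *ᵥ (C *ᵥ X t) = -(Aᵀ *ᵥ (P *ᵥ X t)) - Pᵀ *ᵥ (M *ᵥ X t) := by
      have : Cᵀ * C = -(Aᵀ * P) - Pᵀ * M := by
        rw [← sub_eq_zero, ← hric, hMdef, closedLoop, Matrix.mul_sub]
        simp only [Matrix.mul_assoc]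
        abel
      rw [mulVec_mulVec, this]
      simp only [sub_mulVec, neg_mulVec, mulVec_mulVec]
    have hAM : Aᵀ = Mᵀ + Pᵀ * (B * Bᵀ) := by
      rw [hMdef, closedLoop]
      simp only [transpose_sub, transpose_mul, transpose_transpose, sub_add_cancel]
    have hAν : Aᵀ *ᵥ extendCostate M (l t) = Sum.elim ((Abar M)ᵀ *ᵥ l t) 0 +
        Pᵀ *ᵥ (B *ᵥ ((Bbar M B)ᵀ *ᵥ l t)) := by
      rw [hAM, add_mulVec, closedLoop_transpose_mulVec_extendCostate hM, ← mulVec_mulVec,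
        ← mulVec_mulVec, transpose_mulVec_extendCostate]
    -- The symmetry `E* P = P* E` moves `E` onto the derivative of the state, where the closed loop
    -- equation applies.
    have hPE : Eᵀ *ᵥ (P *ᵥ fullState M B (x' t) (l' t)) =
        Pᵀ *ᵥ (M *ᵥ X t) - Pᵀ *ᵥ (B *ᵥ ((Bbar M B)ᵀ *ᵥ l t)) := by
      rw [mulVec_mulVec, hsymm, ← mulVec_mulVec, hEX, mulVec_sub]
    have hEν : Eᵀ *ᵥ extendCostate M (l' t) = -Sum.elim ((Abar M)ᵀ *ᵥ l t) 0 := by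
      rw [hEt, hE, extendCostate, differential_mulVec_sumElim]
      ext (i | i) <;> simp [l']
    rw [mulVec_add, hPE, hEν, mulVec_add, hAν]
    have hC' : Cᵀ *ᵥ (C *ᵥ (WithLp.toLp 2 (X t) : EuclideanSpace ℝ (d ⊕ a)).ofLp) = _ := hC
    rw [hC']
    abel
  · simp only [U, fullControl, X, mulVec_add, transpose_mulVec_extendCostate]
    abel
  · have h1 : Eᵀ *ᵥ (P *ᵥ X t₁ + extendCostate M (l t₁)) =
        Sum.elim (P.toBlocks₁₁ *ᵥ x t₁ + l t₁) 0 := by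
      simp only [X, fullState, extendCostate]
      rw [mulVec_sumElim, sumElim_add_sumElim, hEt, hE, differential_mulVec_sumElim, hP12,
        zero_mulVec, add_zero]
    rw [h1, hend, ← add_mulVec, add_sub_cancel]
    exact (toBlocks_transpose_mul_self_of_range_le hF _ _).symm

end Optimal

/-! ### Stability of turnpike bounds under linear operations. -/

section Bounds

variable {V : Type*} [NormedAddCommGroup V]

/-- The turnpike bound with rate `σ` for a family of functions indexed by the horizon. -/
def HasTurnpikeBound (f : ℝ → ℝ → V) (σ : ℝ) : Prop :=
  ∃ c : ℝ, 0 ≤ c ∧ ∀ t₁ : ℝ, 0 < t₁ → ∀ t ∈ Icc 0 t₁,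
    ‖f t₁ t‖ ≤ c * (Real.exp (t * σ) + Real.exp ((t₁ - t) * σ))

theorem HasTurnpikeBound.neg {f : ℝ → ℝ → V} {σ : ℝ} (hf : HasTurnpikeBound f σ) :
    HasTurnpikeBound (fun t₁ t => -f t₁ t) σ := by
  simpa only [HasTurnpikeBound, norm_neg] using hf

theorem HasTurnpikeBound.sub {f g : ℝ → ℝ → V} {σ : ℝ} (hf : HasTurnpikeBound f σ)
    (hg : HasTurnpikeBound g σ) : HasTurnpikeBound (fun t₁ t => f t₁ t - g t₁ t) σ := by
  obtain ⟨c, hc, hf⟩ := hf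
  obtain ⟨c', hc', hg⟩ := hg
  refine ⟨c + c', by positivity, fun t₁ ht₁ t ht => ?_⟩
  rw [add_mul]
  exact (norm_sub_le _ _).trans (add_le_add (hf t₁ ht₁ t ht) (hg t₁ ht₁ t ht))

theorem HasTurnpikeBound.clm [NormedSpace ℝ V] {W : Type*} [NormedAddCommGroup W] [NormedSpace ℝ W]
    (T : V →L[ℝ] W) {f : ℝ → ℝ → V} {σ : ℝ} (hf : HasTurnpikeBound f σ) :
    HasTurnpikeBound (fun t₁ t => T (f t₁ t)) σ := by
  obtain ⟨c, hc, hf⟩ := hf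
  refine ⟨‖T‖ * c, by positivity, fun t₁ ht₁ t ht => ?_⟩
  rw [mul_assoc]
  exact (T.le_opNorm _).trans (by gcongr; exact hf t₁ ht₁ t ht)

theorem HasTurnpikeBound.mulVec {α β : Type*} [Fintype α] [Fintype β] [DecidableEq β]
    (N : Matrix α β ℝ) {f : ℝ → ℝ → β → ℝ} {σ : ℝ} (hf : HasTurnpikeBound f σ) :
    HasTurnpikeBound (fun t₁ t => N *ᵥ f t₁ t) σ :=
  HasTurnpikeBound.clm (toLin' N).toContinuousLinearMap hf

theorem HasTurnpikeBound.sumElim {α β : Type*} [Fintype α] [Fintype β] {f : ℝ → ℝ → α → ℝ}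
    {g : ℝ → ℝ → β → ℝ} {σ : ℝ} (hf : HasTurnpikeBound f σ) (hg : HasTurnpikeBound g σ) :
    HasTurnpikeBound (fun t₁ t => Sum.elim (f t₁ t) (g t₁ t)) σ := by
  obtain ⟨c, hc, hf⟩ := hf
  obtain ⟨c', hc', hg⟩ := hg
  refine ⟨c + c', by positivity, fun t₁ ht₁ t ht => ?_⟩
  have h1 := hf t₁ ht₁ t ht
  have h2 := hg t₁ ht₁ t ht
  rw [add_mul]
  rw [pi_norm_le_iff_of_nonneg (by positivity)]
  rintro (i | i)
  · exact ((norm_le_pi_norm _ i).trans h1).trans (le_add_of_nonneg_right (by positivity))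
  · exact ((norm_le_pi_norm _ i).trans h2).trans (le_add_of_nonneg_left (by positivity))

theorem HasTurnpikeBound.toLp {α : Type*} [Fintype α] {f : ℝ → ℝ → α → ℝ} {σ : ℝ}
    (hf : HasTurnpikeBound f σ) :
    HasTurnpikeBound (fun t₁ t => (WithLp.toLp 2 (f t₁ t) : EuclideanSpace ℝ α)) σ :=
  HasTurnpikeBound.clm ((EuclideanSpace.equiv α ℝ).symm : (α → ℝ) →L[ℝ] EuclideanSpace ℝ α) hf

theorem turnpikeBounds_of_hasTurnpikeBound {α β : Type*} [Fintype α] [Fintype β]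
    {x : ℝ → ℝ → EuclideanSpace ℝ α} {u : ℝ → ℝ → EuclideanSpace ℝ β} {σ : ℝ}
    (hx : HasTurnpikeBound x σ) (hu : HasTurnpikeBound u σ) : TurnpikeBounds x u σ := by
  obtain ⟨c, hc, hx⟩ := hx
  obtain ⟨c', hc', hu⟩ := hu
  -- The summand `1` makes the constant strictly positive.
  refine ⟨c + c' + 1, by positivity, fun t₁ ht₁ t ht => ⟨?_, ?_⟩⟩
  · exact (hx t₁ ht₁ t ht).trans (by gcongr; linarith)
  · exact (hu t₁ ht₁ t ht).trans (by gcongr; linarith)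

theorem turnpikeBounds_fullState {d a μ : Type*} [Fintype d] [DecidableEq d] [Fintype a]
    [DecidableEq a] [Fintype μ] [DecidableEq μ] (M P : Matrix (d ⊕ a) (d ⊕ a) ℝ)
    (B : Matrix (d ⊕ a) μ ℝ) {x l : ℝ → ℝ → d → ℝ} {σ : ℝ}
    (hx : HasTurnpikeBound x σ) (hl : HasTurnpikeBound l σ) :
    TurnpikeBounds (fun t₁ t => WithLp.toLp 2 (fullState M B (x t₁ t) (l t₁ t)))
      (fun t₁ t => WithLp.toLp 2 (fullControl M P B (x t₁ t) (l t₁ t))) σ := by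
  have hX : HasTurnpikeBound (fun t₁ t => fullState M B (x t₁ t) (l t₁ t)) σ :=
    hx.sumElim (HasTurnpikeBound.mulVec _ ((HasTurnpikeBound.mulVec _ hx).sub
      (HasTurnpikeBound.mulVec _ (HasTurnpikeBound.mulVec _ hl)))).neg
  exact turnpikeBounds_of_hasTurnpikeBound hX.toLp
    ((HasTurnpikeBound.mulVec _ hl).neg.sub
      (HasTurnpikeBound.mulVec _ (HasTurnpikeBound.mulVec _ hX))).toLp

end Bounds

/-! ### Uniform bounds for the reduced optimal trajectories. -/

section ReducedBounds

attribute [local instance] Matrix.linftyOpNormedRing Matrix.linftyOpNormedAlgebra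

variable {d μ : Type*} [Fintype d] [DecidableEq d] [Fintype μ]

/-- The end value of the reduced optimal state. -/
noncomputable def endState (A : Matrix d d ℝ) (B : Matrix d μ ℝ) (G : Matrix d d ℝ) (x₀ : d → ℝ)
    (t₁ : ℝ) : d → ℝ :=
  (1 + finiteGramian A B t₁ * G)⁻¹ *ᵥ (NormedSpace.exp (t₁ • A) *ᵥ x₀)

theorem reducedState_endState {A : Matrix d d ℝ} {B : Matrix d μ ℝ} {G : Matrix d d ℝ} (x₀ : d → ℝ)
    {t₁ : ℝ} (hu : IsUnit (1 + finiteGramian A B t₁ * G)) :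
    reducedState A B t₁ x₀ (G *ᵥ endState A B G x₀ t₁) t₁ = endState A B G x₀ t₁ := by
  have h : (1 + finiteGramian A B t₁ * G) *ᵥ endState A B G x₀ t₁ =
      NormedSpace.exp (t₁ • A) *ᵥ x₀ := by
    rw [endState, mulVec_mulVec, mul_nonsing_inv _ ((isUnit_iff_isUnit_det _).1 hu), one_mulVec]
  rw [add_mulVec, one_mulVec, ← mulVec_mulVec] at h
  rw [reducedState_self, ← h, add_sub_cancel_right]

/-- The costate decays backwards from the end time, the free motion decays forwards, and the finite
Gramians coupling them are uniformly bounded. -/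
theorem hasTurnpikeBound_reduced {A : Matrix d d ℝ} {B : Matrix d μ ℝ} {G : Matrix d d ℝ}
    {c σ : ℝ} (hc : 0 ≤ c) (hσ : σ < 0)
    (hA : ∀ t : ℝ, 0 ≤ t → ‖NormedSpace.exp (t • A)‖ ≤ c * Real.exp (t * σ))
    (hinf : IsUnit (1 + gramian A B * G))
    (hfin : ∀ t : ℝ, 0 < t → IsUnit (1 + finiteGramian A B t * G)) (x₀ : d → ℝ) :
    HasTurnpikeBound (fun t₁ => costate A t₁ (G *ᵥ endState A B G x₀ t₁)) σ ∧
    HasTurnpikeBound (fun t₁ => reducedState A B t₁ x₀ (G *ᵥ endState A B G x₀ t₁)) σ := by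
  obtain ⟨K, hK, hKb⟩ := exists_norm_inv_one_add_finiteGramian_mul_le hc hσ hA B G hinf hfin
  obtain ⟨w, hw, hwb⟩ := exists_norm_le_of_continuous_of_tendsto
    (continuous_finiteGramian A B).continuousOn (tendsto_finiteGramian hc hσ hA B)
  have hz : ∀ t₁ : ℝ, 0 < t₁ → ‖G *ᵥ endState A B G x₀ t₁‖ ≤ ‖G‖ * (K * (c * ‖x₀‖)) := by
    intro t₁ ht₁
    -- Boundedness of the end value is enough here; its decay in `t₁` is discarded.
    have h1 : Real.exp (t₁ * σ) ≤ 1 := Real.exp_le_one_iff.2 (by nlinarith)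
    calc _ ≤ ‖G‖ * (‖(1 + finiteGramian A B t₁ * G)⁻¹‖ *
            (‖NormedSpace.exp (t₁ • A)‖ * ‖x₀‖)) :=
          (norm_mulVec_le_linftyOpNorm_mul _ _).trans (by
            gcongr
            exact (norm_mulVec_le_linftyOpNorm_mul _ _).trans (by
              gcongr; exact norm_mulVec_le_linftyOpNorm_mul _ _))
      _ ≤ _ := by
          gcongr
          · exact hKb t₁ ht₁.le
          · exact (hA t₁ ht₁.le).trans (mul_le_of_le_one_right hc h1)
  set c₁ : ℝ := Fintype.card d * c * (‖G‖ * (K * (c * ‖x₀‖))) with hc₁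
  have hl : ∀ t₁ : ℝ, 0 < t₁ → ∀ t ∈ Icc 0 t₁,
      ‖costate A t₁ (G *ᵥ endState A B G x₀ t₁) t‖ ≤ c₁ * Real.exp ((t₁ - t) * σ) := by
    intro t₁ ht₁ t ht
    calc _ ≤ ‖NormedSpace.exp ((t₁ - t) • Aᵀ)‖ * ‖G *ᵥ endState A B G x₀ t₁‖ :=
          norm_mulVec_le_linftyOpNorm_mul _ _
      _ ≤ Fintype.card d * c * Real.exp ((t₁ - t) * σ) * (‖G‖ * (K * (c * ‖x₀‖))) := by
          gcongr
          · exact norm_exp_smul_transpose_le hA _ (sub_nonneg.2 ht.2)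
          · exact hz t₁ ht₁
      _ = _ := by rw [hc₁]; ring
  have hc₁0 : 0 ≤ c₁ := by positivity
  refine ⟨⟨c₁, hc₁0, fun t₁ ht₁ t ht => (hl t₁ ht₁ t ht).trans ?_⟩,
    ⟨c * ‖x₀‖ + w * c₁, by positivity, fun t₁ ht₁ t ht => ?_⟩⟩
  · gcongr
    exact le_add_of_nonneg_left (Real.exp_pos _).le
  · have h1 : ‖NormedSpace.exp (t • A) *ᵥ x₀‖ ≤ c * ‖x₀‖ * Real.exp (t * σ) := by
      calc _ ≤ ‖NormedSpace.exp (t • A)‖ * ‖x₀‖ := norm_mulVec_le_linftyOpNorm_mul _ _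
        _ ≤ c * Real.exp (t * σ) * ‖x₀‖ := by gcongr; exact hA t ht.1
        _ = _ := by ring
    have h2 : ‖finiteGramian A B t *ᵥ costate A t₁ (G *ᵥ endState A B G x₀ t₁) t‖ ≤
        w * c₁ * Real.exp ((t₁ - t) * σ) := by
      calc _ ≤ ‖finiteGramian A B t‖ * ‖costate A t₁ (G *ᵥ endState A B G x₀ t₁) t‖ :=
            norm_mulVec_le_linftyOpNorm_mul _ _
        _ ≤ w * (c₁ * Real.exp ((t₁ - t) * σ)) := by
            gcongr
            exacts [hwb t ht.1, hl t₁ ht₁ t ht]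
        _ = _ := by ring
    have h3 : 0 ≤ c * ‖x₀‖ * Real.exp ((t₁ - t) * σ) := by positivity
    have h4 : 0 ≤ w * c₁ * Real.exp (t * σ) := by positivity
    calc _ ≤ ‖NormedSpace.exp (t • A) *ᵥ x₀‖ +
          ‖finiteGramian A B t *ᵥ costate A t₁ (G *ᵥ endState A B G x₀ t₁) t‖ := norm_sub_le _ _
      _ ≤ _ := by linarith

end ReducedBounds

end DAETurnpike

/-! ### Assembly of the main theorem. -/

theorem mainTheorem3 {d a m k l : ℕ} (hd : 0 < d)
    (E A : Matrix (Fin d ⊕ Fin a) (Fin d ⊕ Fin a) ℝ)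
    (B : Matrix (Fin d ⊕ Fin a) (Fin m) ℝ)
    (C : Matrix (Fin k) (Fin d ⊕ Fin a) ℝ)
    (F : Matrix (Fin l) (Fin d ⊕ Fin a) ℝ)
    (x₀ : EuclideanSpace ℝ (Fin d ⊕ Fin a))
    (hE : E = Matrix.fromBlocks 1 0 0 0)
    (hF : LinearMap.range Fᵀ.mulVecLin ≤ LinearMap.range Eᵀ.mulVecLin)
    (hreg : DAETurnpike.IsRegularPair E A)
    (P : Matrix (Fin d ⊕ Fin a) (Fin d ⊕ Fin a) ℝ)
    (hP : DAETurnpike.IsStabilizingSolution E A B C P)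
    (hQ : (DAETurnpike.Qtilde A B C P).PosSemidef)
    (Abar : Matrix (Fin d) (Fin d) ℝ)
    (hAbar : Abar = DAETurnpike.Abar (DAETurnpike.closedLoop A B P))
    (Bbar : Matrix (Fin d) (Fin m) ℝ)
    (hBbar : Bbar = DAETurnpike.Bbar (DAETurnpike.closedLoop A B P) B)
    (hW : IsUnit (1 + DAETurnpike.gramian Abar Bbar *
      ((Fᵀ * F).toBlocks₁₁ - P.toBlocks₁₁))) :
    DAETurnpike.spectralAbscissa Abar < 0 ∧
    ∃ (x : ℝ → ℝ → EuclideanSpace ℝ (Fin d ⊕ Fin a)) (u : ℝ → ℝ → EuclideanSpace ℝ (Fin m)),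
      (∀ t₁ : ℝ, 0 < t₁ → DAETurnpike.IsOptimal E A B C F 0 0 x₀ t₁ (x t₁) (u t₁)) ∧
      (DAETurnpike.HasSemisimpleAbscissa Abar →
        DAETurnpike.TurnpikeBounds x u (DAETurnpike.spectralAbscissa Abar)) ∧
      (∀ σ ∈ Set.Ioo (DAETurnpike.spectralAbscissa Abar) 0, DAETurnpike.TurnpikeBounds x u σ) := by
  open DAETurnpike in
  have : Nonempty (Fin d) := ⟨⟨0, hd⟩⟩
  subst hE
  set M := closedLoop A B P with hM
  have hM22 : IsUnit M.toBlocks₂₂ := isUnit_toBlocks₂₂_of_isImpulseFree hP.impulseFree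
  obtain ⟨hP1, hP12⟩ := blocks_of_symm hP.symm
  obtain ⟨-, W, hJ⟩ := hP.stable
  have hneg : spectralAbscissa Abar < 0 := by
    rw [hAbar]
    exact spectralAbscissa_neg fun μ hμ => hJ μ (spectrum_Abar_subset hM22 W hμ)
  have hspec : ∀ σ, spectralAbscissa Abar < σ → ∀ μ ∈ spectrum ℂ (toComplex Abar), μ.re < σ :=
    fun σ hσ μ hμ => (re_le_spectralAbscissa hμ).trans_lt hσ
  -- Half the abscissa is negative and strictly above the spectrum, so the Lyapunov equation is
  -- available without semisimplicity.
  obtain ⟨c₀, hc₀, hA₀⟩ := exists_norm_exp_smul_le Abar (spectralAbscissa Abar / 2)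
    fun μ hμ => Or.inl (hspec _ (by linarith) μ hμ)
  have hlyap := gramian_lyapunov hc₀ (by linarith) hA₀ Bbar
  have hric := reduced_riccati hP.riccati hP1 hP12 hM22
  rw [← hM, ← hAbar, ← hBbar] at hric
  have hS : ∀ v, 0 ≤ v ⬝ᵥ (Fᵀ * F).toBlocks₁₁ *ᵥ v := fun v => by
    have h : (Fᵀ * F).toBlocks₁₁ = F.toCols₁ᵀ * F.toCols₁ := by
      rw [transpose_mul_eq_fromBlocks_toCols, toBlocks_fromBlocks₁₁]
    rw [h, ← mulVec_mulVec, dotProduct_mulVec, ← mulVec_transpose, transpose_transpose]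
    simpa using dotProduct_star_self_nonneg (F.toCols₁ *ᵥ v)
  have hfin : ∀ t : ℝ, 0 < t →
      IsUnit (1 + finiteGramian Abar Bbar t * ((Fᵀ * F).toBlocks₁₁ - P.toBlocks₁₁)) := fun t ht =>
    isUnit_one_add_finiteGramian_mul hlyap hP1
      (fun v => by simpa using hQ.dotProduct_mulVec_nonneg v) hS hric ht
  set G := (Fᵀ * F).toBlocks₁₁ - P.toBlocks₁₁ with hG
  set y₀ : Fin d → ℝ := fun i => x₀ (Sum.inl i)
  set lam : ℝ → ℝ → Fin d → ℝ := fun t₁ => costate Abar t₁ (G *ᵥ endState Abar Bbar G y₀ t₁)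
  set x₁ : ℝ → ℝ → Fin d → ℝ :=
    fun t₁ => reducedState Abar Bbar t₁ y₀ (G *ᵥ endState Abar Bbar G y₀ t₁)
  -- The trajectories do not depend on `σ`, so one family of pairs serves both cases.
  have hbound : ∀ σ < 0, (∀ μ ∈ spectrum ℂ (toComplex Abar), μ.re < σ ∨ (μ.re = σ ∧
      ∀ v : Fin d → ℂ, (toComplex Abar - μ • 1) ^ 2 *ᵥ v = 0 →
        (toComplex Abar - μ • 1) *ᵥ v = 0)) →
      TurnpikeBounds (fun t₁ t => WithLp.toLp 2 (fullState M B (x₁ t₁ t) (lam t₁ t)))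
        (fun t₁ t => WithLp.toLp 2 (fullControl M P B (x₁ t₁ t) (lam t₁ t))) σ := fun σ hσ h => by
    obtain ⟨c, hc, hA⟩ := exists_norm_exp_smul_le Abar σ h
    have hb := hasTurnpikeBound_reduced hc hσ hA hW hfin y₀
    exact turnpikeBounds_fullState M P B hb.2 hb.1
  refine ⟨hneg, fun t₁ t => WithLp.toLp 2 (fullState M B (x₁ t₁ t) (lam t₁ t)),
    fun t₁ t => WithLp.toLp 2 (fullControl M P B (x₁ t₁ t) (lam t₁ t)), fun t₁ ht₁ => ?_,
    fun hss => hbound _ hneg ?_, fun σ hσ => hbound σ hσ.2 fun μ hμ => Or.inl (hspec σ hσ.1 μ hμ)⟩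
  · refine isOptimal_of_reduced hF hP.riccati hP.symm hM hM22 ht₁ (fun t => ?_) (fun t => ?_)
      (reducedState_zero ..) ?_
    · rw [← hAbar, ← hBbar]
      exact hasDerivAt_reducedState hlyap t₁ y₀ _ t
    · rw [← hAbar]
      exact hasDerivAt_costate Abar t₁ _ t
    · simp only [x₁, lam]
      rw [costate_self, reducedState_endState y₀ (hfin t₁ ht₁)]
  · exact fun μ hμ =>
      (re_le_spectralAbscissa hμ).lt_or_eq.imp_right fun h => ⟨h, hss μ hμ h⟩
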